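/- Let $L_2(\mathbb{R})$ be the real or the complex space of square-integrable functions, and for $f\in L_2(\mathbb{R})$ let $\widehat f$ be its Fourier transform, normalized by $\widehat f(y)=\frac{1}{2\pi}\int_{\mathbb{R}}f(x)e^{-ixy}\,dx$ on $L_1(\mathbb{R})\cap L_2(\mathbb{R})$. Let $\sigma>0$ and let $B\in L_2(\mathbb{R})$ be such that the shifts $B(\cdot-\frac{j\pi}{\sigma})$, $j\in\mathbb{Z}$, form a Riesz system in $L_2(\mathbb{R})$; that is, for some $A,C>0$ and every $\beta\in\ell_2(\mathbb{Z})$ (with entries in the same scalar field) the series $\sum_j\beta_jB(\cdot-\frac{j\pi}{\sigma})$ converges in $L_2(\mathbb{R})$ and $A\|\beta\|^2\le\|\sum_j\beta_jB(\cdot-\frac{j\pi}{\sigma})\|^2\le C\|\beta\|^2$. Put $$\Phi_{B,\sigma}(x,y)=\frac1{2\sigma}\sum_{j\in\mathbb{Z}}B\Big(x-\frac{j\pi}{\sigma}\Big)e^{i\frac{j\pi}{\sigma}y},\qquad D_{B,\sigma}(y)=\sum_{\nu\in\mathbb{Z}}|\widehat B(y+2\nu\sigma)|^2,$$ where for a.e.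 $x$ the first series converges in $L_2[-\sigma,\sigma]$ with respect to $y$. For $f\in L_2(\mathbb{R})$ put $$\zeta_{B,\sigma}(f,y)=\frac{1}{2\pi D_{B,\sigma}(y)}\int_{\mathbb{R}}f(t)\overline{\Phi_{B,\sigma}(t,y)}\,dt,$$ where the integral is the limit in $L_2[-\sigma,\sigma]$ of the integrals over $[-n,n]$ as $n\to\infty$. For $0<\rho\le\sigma$ let $\mathbb{S}_{B,\sigma,\rho}$ be the set of all $s=\sum_j\beta_jB(\cdot-\frac{j\pi}{\sigma})$ with $\beta\in\ell_2(\mathbb{Z})$ such that $\sum_j\beta_je^{-i\frac{j\pi}{\sigma}y}=0$ for a.e. $y$ with $\rho<|y|\le\sigma$ (the series taken in $L_2[-\sigma,\sigma]$), and let $E(f,\mathbb{S}_{B,\sigma,\rho})_2=\inf_{s\in\mathbb{S}_{B,\sigma,\rho}}\|f-s\|_{L_2(\mathbb{R})}$. Then, for every $f\in L_2(\mathbb{R})$, these objects are well defined, $$\zeta_{B,\sigma}(f)=\frac{1}{D_{B,\sigma}}\sum_{k\in\mathbb{Z}}\overline{\widehat B(\cdot+2k\sigma)}\,\widehat f(\cdot+2k\sigma)\quad\text{in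 }L_2[-\sigma,\sigma]$$ (the series on the right converging absolutely a.e. and, after division by $D_{B,\sigma}$, in $L_2[-\sigma,\sigma]$), and for every $0<\rho\le\sigma$ $$E^2(f,\mathbb{S}_{B,\sigma,\rho})_2=2\pi\left(\int_{\mathbb{R}}|\widehat f(y)|^2dy-\int_{-\rho}^{\rho}\frac{1}{D_{B,\sigma}(y)}\Big|\sum_{k\in\mathbb{Z}}\overline{\widehat B(y+2k\sigma)}\,\widehat f(y+2k\sigma)\Big|^2dy\right).$$ -/

import Mathlib

open MeasureTheory Filter Topology FourierTransform

noncomputable section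

namespace ShiftSpace

/-- `L₂(ℝ)`, real or complex according to the scalar field `𝕜`. -/
abbrev L2R (𝕜 : Type*) [RCLike 𝕜] : Type _ := Lp 𝕜 2 (volume : Measure ℝ)

/-- Lebesgue measure on `[-σ, σ]`. -/
abbrev mu (σ : ℝ) : Measure ℝ := volume.restrict (Set.Icc (-σ) σ)

/-- The complex space `L₂[-σ, σ]`. -/
abbrev L2I (σ : ℝ) : Type := Lp ℂ 2 (mu σ)

/-- The inclusion of the scalar field `𝕜` (`ℝ` or `ℂ`) into `ℂ`. -/
abbrev toC (𝕜 : Type*) [RCLike 𝕜] : 𝕜 →L[ℝ] ℂ := RCLike.map 𝕜 ℂ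

/-- The Fourier transform on `L₂(ℝ)` normalized so that
`f̂(y) = (1 / 2π) ∫ f(x) exp(-i x y) dx` for `f ∈ L₁ ∩ L₂`.
Mathlib's Plancherel transform `𝓕` extends `ξ ↦ ∫ f(x) exp(-2π i x ξ) dx`, whence the rescaling. -/
def hat {𝕜 : Type*} [RCLike 𝕜] (f : L2R 𝕜) (y : ℝ) : ℂ :=
  (1 / (2 * Real.pi) : ℂ) * (𝓕 ((toC 𝕜).compLp f) : L2R ℂ) (y / (2 * Real.pi))

/-- The shift `B(· - a)` of an element of `L₂(ℝ)`. -/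
def shift {𝕜 : Type*} [RCLike 𝕜] (a : ℝ) (B : L2R 𝕜) : L2R 𝕜 :=
  Lp.compMeasurePreserving (fun x : ℝ => x - a) (measurePreserving_sub_right volume a) B

/-- A family `v : ℤ → H` is a Riesz system: for some `A, C > 0` and every `β ∈ ℓ₂(ℤ)` the series
`∑ β_j v_j` converges and `A ‖β‖² ≤ ‖∑ β_j v_j‖² ≤ C ‖β‖²`. -/
def IsRieszSystem (𝕜 : Type*) [RCLike 𝕜] {H : Type*} [NormedAddCommGroup H]
    [InnerProductSpace 𝕜 H] (v : ℤ → H) : Prop :=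
  ∃ A C : ℝ, 0 < A ∧ 0 < C ∧ ∀ β : lp (fun _ : ℤ => 𝕜) 2,
    Summable (fun j : ℤ => β j • v j) ∧
    A * ‖β‖ ^ 2 ≤ ‖∑' j : ℤ, β j • v j‖ ^ 2 ∧
    ‖∑' j : ℤ, β j • v j‖ ^ 2 ≤ C * ‖β‖ ^ 2

/-- The function `y ↦ exp(i j π y / σ)`. -/
def trigFun (σ : ℝ) (j : ℤ) (y : ℝ) : ℂ :=
  Complex.exp (Complex.I * ((j * Real.pi / σ * y : ℝ) : ℂ))

theorem memLp_trigFun (σ : ℝ) (j : ℤ) : MemLp (trigFun σ j) 2 (mu σ) := by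
  have hc : Continuous (trigFun σ j) := by
    unfold trigFun
    fun_prop
  refine MemLp.of_bound hc.aestronglyMeasurable 1 (Eventually.of_forall fun y => ?_)
  rw [trigFun, mul_comm, Complex.norm_exp_ofReal_mul_I]

/-- `exp(i j π y / σ)` as an element of `L₂[-σ, σ]`. -/
def trig (σ : ℝ) (j : ℤ) : L2I σ := (memLp_trigFun σ j).toLp (trigFun σ j)

/-- `Φ_{B,σ}(x, ·) = (1 / 2σ) ∑_j B(x - jπ/σ) exp(i j π · / σ)`, the series being taken
in `L₂[-σ, σ]` (it converges there for almost every `x`). -/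
def Phi {𝕜 : Type*} [RCLike 𝕜] (B : L2R 𝕜) (σ : ℝ) (x : ℝ) : L2I σ :=
  (1 / (2 * σ) : ℂ) • ∑' j : ℤ, toC 𝕜 (B (x - j * Real.pi / σ)) • trig σ j

/-- `D_{B,σ}(y) = ∑_ν |B̂(y + 2νσ)|²`. -/
def D {𝕜 : Type*} [RCLike 𝕜] (B : L2R 𝕜) (σ : ℝ) (y : ℝ) : ℝ :=
  ∑' ν : ℤ, ‖hat B (y + 2 * ν * σ)‖ ^ 2

/-- The function `y ↦ ∫_{-n}^{n} f(t) conj (Φ_{B,σ}(t, y)) dt`, an element of `L₂[-σ, σ]`;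
since `Φ_{B,σ}` is a function of `t` with values in `L₂[-σ, σ]`, the integral is the
integral of such a function. -/
def truncInt {𝕜 : Type*} [RCLike 𝕜] (B : L2R 𝕜) (σ : ℝ) (f : L2R 𝕜) (n : ℕ) : L2I σ :=
  ∫ t in (-(n : ℝ))..(n : ℝ), toC 𝕜 (f t) • star (Phi B σ t)

/-- The function `y ↦ ∫_ℝ f(t) conj (Φ_{B,σ}(t, y)) dt`, the integral converging in
`L₂[-σ, σ]`. -/
def fullInt {𝕜 : Type*} [RCLike 𝕜] (B : L2R 𝕜) (σ : ℝ) (f : L2R 𝕜) : L2I σ :=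
  limUnder atTop (truncInt B σ f)

/-- The Fourier transform of `f` with respect to the system `Φ_{B,σ}`:
`ζ_{B,σ}(f, y) = (1 / (2π D_{B,σ}(y))) ∫_ℝ f(t) conj (Φ_{B,σ}(t, y)) dt`. -/
def zeta {𝕜 : Type*} [RCLike 𝕜] (B : L2R 𝕜) (σ : ℝ) (f : L2R 𝕜) (y : ℝ) : ℂ :=
  (1 / (2 * Real.pi * D B σ y) : ℂ) * fullInt B σ f y

/-- The term `conj (B̂(y + 2kσ)) f̂(y + 2kσ)`. -/
def crossTerm {𝕜 : Type*} [RCLike 𝕜] (B : L2R 𝕜) (σ : ℝ) (f : L2R 𝕜) (k : ℤ) (y : ℝ) : ℂ :=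
  (starRingEnd ℂ) (hat B (y + 2 * k * σ)) * hat f (y + 2 * k * σ)

/-- The series `∑_j β_j exp(-i j π y / σ)`, taken in `L₂[-σ, σ]`. -/
def trigSeries {𝕜 : Type*} [RCLike 𝕜] (σ : ℝ) (β : lp (fun _ : ℤ => 𝕜) 2) : L2I σ :=
  ∑' j : ℤ, toC 𝕜 (β j) • trig σ (-j)

/-- The space `𝕊_{B,σ,ρ}` of all `s = ∑_j β_j B(· - jπ/σ)` with `β ∈ ℓ₂(ℤ)` such that
`∑_j β_j exp(-i j π y / σ) = 0` for a.e. `y` with `ρ < |y| ≤ σ`. The last condition is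
empty for `ρ = σ`. -/
def shiftSpace {𝕜 : Type*} [RCLike 𝕜] (B : L2R 𝕜) (σ ρ : ℝ) : Set (L2R 𝕜) :=
  {s | ∃ β : lp (fun _ : ℤ => 𝕜) 2,
    HasSum (fun j : ℤ => β j • shift (j * Real.pi / σ) B) s ∧
    ∀ᵐ y ∂(mu σ), ρ < |y| ∧ |y| ≤ σ → trigSeries σ β y = 0}

/-- The best approximation `E(f, N)₂ = inf_{T ∈ N} ‖f - T‖₂`. -/
def bestApprox {𝕜 : Type*} [RCLike 𝕜] (f : L2R 𝕜) (N : Set (L2R 𝕜)) : ℝ :=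
  ⨅ T : N, ‖f - (T : L2R 𝕜)‖

end ShiftSpace

end

noncomputable section

namespace ShiftSpace

open scoped ENNReal

/-! ### Plancherel identities in the normalization of `hat` -/

section HatBasics

/-! On the Fourier side the problem splits into independent one-dimensional least-squares problems.
Attach to `f` and to a point `y` of `[-σ, σ]` the fibre `v = (f̂(y + 2kσ))_k`, and let `u = (B̂(y +
2kσ))_k`. By Plancherel and periodization `‖f‖² = 2π ∫ ‖v‖² dy` over `[-σ, σ]`, with `v` in `ℓ₂` for
a.e. `y`, and `D = ‖u‖²`. A series `s = ∑ β_j B(· - jπ/σ)` satisfies `ŝ = S B̂` with the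
`2σ`-periodic `S = ∑ β_j exp(-ijπ·/σ)`, so its fibre is `S(y) u` (`hat_eq_trigSeries_mul`). Hence
`‖s‖² = 2π ∫ |S|² D`, while `2σ‖β‖² = ∫ |S|²`. Testing the Riesz inequalities on `S = 1_E` bounds
`D` a.e. above and away from zero (`exists_D_bounds`).

In each fibre, completing the square (`tsum_norm_sub_mul_sq`) gives `‖v - S u‖² = ‖v‖² - |⟨u, v⟩|²/D
+ D |S - ⟨u, v⟩/D|²`. The minimizer is `⟨u, v⟩/D`, which is `ζ` by the transform formula. Taking `S
= ζ` on `[-ρ, ρ]` and the forced `S = 0` outside, and integrating, gives the value of the best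
approximation. It is attained: `ζ` lies in `L₂`, because `D` is bounded below, and every function in
`L₂[-σ, σ]` is such an `S`.

The transform formula is checked on Fourier coefficients. Those of the truncated integral are inner
products of shifts of `B` with the truncated `f`; by Plancherel those of the cross series are the
same up to `1/2π` (`inner_trig_truncInt`, `inner_trig_crossLp`). Continuity of the cross series in
`f` removes the truncation.

All this is done over `ℂ`. A general scalar field is embedded in `ℂ`, and a norm-nonincreasing
retraction brings the complex minimizer back. -/

theorem toC_complex (z : ℂ) : toC ℂ z = z := by simp [toC]

theorem compLp_toC_complex (f : L2R ℂ) : (toC ℂ).compLp f = f := by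
  refine Lp.ext ?_
  filter_upwards [(toC ℂ).coeFn_compLp f] with x hx
  rw [hx, toC_complex]

theorem hat_complex (f : L2R ℂ) (y : ℝ) :
    hat f y = (1 / (2 * Real.pi) : ℂ) * (𝓕 f : L2R ℂ) (y / (2 * Real.pi)) := by
  rw [hat, compLp_toC_complex]

theorem hat_compLp_toC {𝕜 : Type*} [RCLike 𝕜] (f : L2R 𝕜) : hat ((toC 𝕜).compLp f) = hat f := by
  ext y
  rw [hat_complex, hat]

theorem lintegral_comp_div_two_pi (g : ℝ → ℝ≥0∞) :
    ∫⁻ y : ℝ, g (y / (2 * Real.pi)) = ENNReal.ofReal (2 * Real.pi) * ∫⁻ y, g y := by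
  have h0 : (2 * Real.pi)⁻¹ ≠ 0 := by positivity
  have hm := (measurableEmbedding_mulRight₀ h0).lintegral_map (μ := (volume : Measure ℝ)) g
  rw [Real.map_volume_mul_right h0, lintegral_smul_measure, inv_inv,
    abs_of_pos (by positivity)] at hm
  simpa [div_eq_mul_inv] using hm.symm

theorem integral_comp_div_two_pi (g : ℝ → ℂ) :
    ∫ y : ℝ, g (y / (2 * Real.pi)) = (2 * Real.pi : ℂ) * ∫ y, g y := by
  rw [Measure.integral_comp_div, abs_of_pos (by positivity)]
  simp

theorem quasiMeasurePreserving_div_two_pi :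
    Measure.QuasiMeasurePreserving (fun y : ℝ => y / (2 * Real.pi)) volume volume := by
  have h0 : (2 * Real.pi)⁻¹ ≠ 0 := by positivity
  refine ⟨by fun_prop, ?_⟩
  have := Real.map_volume_mul_right h0
  simp only [div_eq_mul_inv]
  rw [this]
  exact Measure.smul_absolutelyContinuous

theorem aestronglyMeasurable_hat (f : L2R ℂ) : AEStronglyMeasurable (hat f) volume := by
  have h : hat f = fun y => (1 / (2 * Real.pi) : ℂ) * (𝓕 f : L2R ℂ) (y / (2 * Real.pi)) :=
    funext (hat_complex f)
  rw [h]
  exact ((Lp.aestronglyMeasurable (𝓕 f : L2R ℂ)).comp_quasiMeasurePreserving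
    quasiMeasurePreserving_div_two_pi).const_mul _

theorem hat_congr_of_fourier {f : L2R ℂ} {g : ℝ → ℂ} (h : (𝓕 f : L2R ℂ) =ᵐ[volume] g) :
    ∀ᵐ y : ℝ, hat f y = (1 / (2 * Real.pi) : ℂ) * g (y / (2 * Real.pi)) := by
  filter_upwards [quasiMeasurePreserving_div_two_pi.ae_eq_comp h] with y hy
  rw [hat_complex]
  exact congrArg _ hy

theorem hat_sub (f g : L2R ℂ) : ∀ᵐ y : ℝ, hat (f - g) y = hat f y - hat g y := by
  have h : (𝓕 (f - g) : L2R ℂ) = 𝓕 f - 𝓕 g := (Lp.fourierTransformₗᵢ ℝ ℂ).map_sub f g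
  have h' : (𝓕 (f - g) : L2R ℂ) =ᵐ[volume] ⇑(𝓕 f : L2R ℂ) - ⇑(𝓕 g : L2R ℂ) := by
    rw [h]
    exact Lp.coeFn_sub _ _
  filter_upwards [hat_congr_of_fourier h'] with y hy
  rw [hy, hat_complex, hat_complex, Pi.sub_apply, mul_sub]

theorem hat_smul (c : ℂ) (f : L2R ℂ) : ∀ᵐ y : ℝ, hat (c • f) y = c * hat f y := by
  have h : (𝓕 (c • f) : L2R ℂ) = c • 𝓕 f := (Lp.fourierTransformₗᵢ ℝ ℂ).map_smul c f
  have h' : (𝓕 (c • f) : L2R ℂ) =ᵐ[volume] c • ⇑(𝓕 f : L2R ℂ) := by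
    rw [h]
    exact Lp.coeFn_smul _ _
  filter_upwards [hat_congr_of_fourier h'] with y hy
  rw [hy, hat_complex, Pi.smul_apply, smul_eq_mul]
  ring

theorem hat_add (f g : L2R ℂ) : ∀ᵐ y : ℝ, hat (f + g) y = hat f y + hat g y := by
  have h : (𝓕 (f + g) : L2R ℂ) = 𝓕 f + 𝓕 g := (Lp.fourierTransformₗᵢ ℝ ℂ).map_add f g
  have h' : (𝓕 (f + g) : L2R ℂ) =ᵐ[volume] ⇑(𝓕 f : L2R ℂ) + ⇑(𝓕 g : L2R ℂ) := by
    rw [h]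
    exact Lp.coeFn_add _ _
  filter_upwards [hat_congr_of_fourier h'] with y hy
  rw [hy, hat_complex, hat_complex, Pi.add_apply, mul_add]

theorem hat_zero : ∀ᵐ y : ℝ, hat (0 : L2R ℂ) y = 0 := by
  filter_upwards [hat_smul 0 (0 : L2R ℂ)] with y hy
  rw [zero_smul, zero_mul] at hy
  exact hy

theorem hat_sum {ι : Type*} (K : Finset ι) (f : ι → L2R ℂ) :
    ∀ᵐ y : ℝ, hat (∑ j ∈ K, f j) y = ∑ j ∈ K, hat (f j) y := by
  classical
  induction K using Finset.induction_on with
  | empty => simpa using hat_zero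
  | insert a s ha ih =>
    filter_upwards [ih, hat_add (f a) (∑ j ∈ s, f j)] with y h1 h2
    rw [Finset.sum_insert ha, Finset.sum_insert ha, h2, h1]

theorem enorm_sq_eq_lintegral {α : Type*} [MeasurableSpace α] {μ : Measure α} (f : Lp ℂ 2 μ) :
    ∫⁻ x, ‖f x‖ₑ ^ 2 ∂μ = ENNReal.ofReal (‖f‖ ^ 2) := by
  have h := eLpNorm_nnreal_pow_eq_lintegral (μ := μ) (f := f) (p := 2) two_ne_zero
  simp only [ENNReal.coe_ofNat, NNReal.coe_ofNat] at h
  rw [ENNReal.ofReal_pow (norm_nonneg _), Lp.norm_def, ENNReal.ofReal_toReal (Lp.eLpNorm_ne_top f)]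
  exact_mod_cast h.symm

theorem lintegral_hat (f : L2R ℂ) :
    ∫⁻ y : ℝ, ‖hat f y‖ₑ ^ 2 = ENNReal.ofReal (‖f‖ ^ 2 / (2 * Real.pi)) := by
  have h1 : ∀ y, ‖hat f y‖ₑ ^ 2 = ENNReal.ofReal ((1 / (2 * Real.pi)) ^ 2) *
      (fun x => ‖(𝓕 f : L2R ℂ) x‖ₑ ^ 2) (y / (2 * Real.pi)) := by
    intro y
    rw [hat_complex, enorm_mul, mul_pow, ENNReal.ofReal_pow (by positivity), ← ofReal_norm]
    congr 3
    simp [abs_of_pos Real.pi_pos]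
  simp_rw [h1]
  rw [lintegral_const_mul' _ _ ENNReal.ofReal_ne_top,
    lintegral_comp_div_two_pi (fun x => ‖(𝓕 f : L2R ℂ) x‖ₑ ^ 2),
    enorm_sq_eq_lintegral, Lp.norm_fourier_eq, ← ENNReal.ofReal_mul (by positivity),
    ← ENNReal.ofReal_mul (by positivity)]
  -- The factor `(1/2π)²` from the normalization meets the Jacobian `2π` of the dilation.
  congr 1
  field_simp

theorem memLp_two_of_lintegral_lt_top {α : Type*} [MeasurableSpace α] {μ : Measure α} {f : α → ℂ}
    (hf : AEStronglyMeasurable f μ) (h : ∫⁻ x, ‖f x‖ₑ ^ 2 ∂μ < ∞) : MemLp f 2 μ := by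
  refine ⟨hf, ?_⟩
  have h' := eLpNorm_nnreal_pow_eq_lintegral (μ := μ) (f := f) (p := 2) two_ne_zero
  simp only [ENNReal.coe_ofNat, NNReal.coe_ofNat] at h'
  by_contra hne
  rw [not_lt, top_le_iff] at hne
  rw [hne] at h'
  have : ∫⁻ x, ‖f x‖ₑ ^ 2 ∂μ = ∞ := by
    rw [← ENNReal.top_rpow_of_pos (y := 2) (by norm_num), h']
    simp
  exact h.ne this

theorem memLp_hat (f : L2R ℂ) : MemLp (hat f) 2 volume :=
  memLp_two_of_lintegral_lt_top (aestronglyMeasurable_hat f)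
    (by rw [lintegral_hat]; exact ENNReal.ofReal_lt_top)

theorem integral_hat (f : L2R ℂ) :
    ∫ y : ℝ, ‖hat f y‖ ^ 2 = ‖f‖ ^ 2 / (2 * Real.pi) := by
  have hm : AEStronglyMeasurable (fun y => ‖hat f y‖ ^ 2) volume :=
    (aestronglyMeasurable_hat f).norm.pow 2
  rw [integral_eq_lintegral_of_nonneg_ae (Eventually.of_forall fun y => by positivity) hm]
  simp_rw [ENNReal.ofReal_pow (norm_nonneg _), ofReal_norm]
  rw [lintegral_hat, ENNReal.toReal_ofReal (by positivity)]

theorem integral_conj_hat_mul_hat (f g : L2R ℂ) :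
    ∫ y : ℝ, (starRingEnd ℂ) (hat f y) * hat g y = (1 / (2 * Real.pi) : ℂ) * inner ℂ f g := by
  have h1 : ∀ y, (starRingEnd ℂ) (hat f y) * hat g y = (1 / (2 * Real.pi) : ℂ) ^ 2 *
      (fun x => inner ℂ ((𝓕 f : L2R ℂ) x) ((𝓕 g : L2R ℂ) x)) (y / (2 * Real.pi)) := by
    intro y
    rw [hat_complex, hat_complex]
    simp only [map_mul, map_div₀, map_one, map_ofNat, Complex.conj_ofReal, RCLike.inner_apply]
    ring
  simp_rw [h1]
  rw [integral_const_mul, integral_comp_div_two_pi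
    (fun x => inner ℂ ((𝓕 f : L2R ℂ) x) ((𝓕 g : L2R ℂ) x)), ← L2.inner_def, Lp.inner_fourier_eq]
  have : (Real.pi : ℂ) ≠ 0 := by exact_mod_cast Real.pi_ne_zero
  field_simp

end HatBasics

/-! ### Fourier transform of a shift -/

section HatShift

theorem shift_coeFn {𝕜 : Type*} [RCLike 𝕜] (a : ℝ) (B : L2R 𝕜) :
    ∀ᵐ x : ℝ, shift a B x = B (x - a) :=
  Lp.coeFn_compMeasurePreserving B (measurePreserving_sub_right volume a)

theorem fourier_compSubConst (a : ℝ) (φ : SchwartzMap ℝ ℂ) (ξ : ℝ) :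
    𝓕 (φ.compSubConstCLM ℂ a) ξ = Complex.exp (-(2 * Real.pi * Complex.I * a * ξ)) * 𝓕 φ ξ := by
  rw [SchwartzMap.fourier_coe, SchwartzMap.fourier_coe, Real.fourier_real_eq_integral_exp_smul,
    Real.fourier_real_eq_integral_exp_smul, ← integral_const_mul,
    ← integral_sub_right_eq_self (fun v : ℝ => Complex.exp (-(2 * Real.pi * Complex.I * a * ξ)) *
      Complex.exp ((-2 * Real.pi * v * ξ : ℝ) * Complex.I) • φ v) a]
  refine integral_congr_ae (Eventually.of_forall fun v => ?_)
  simp only [SchwartzMap.compSubConstCLM_apply, smul_eq_mul]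
  rw [← mul_assoc, ← Complex.exp_add]
  congr 2
  push_cast
  ring

theorem memLp_exp_mul (a : ℝ) (g : L2R ℂ) :
    MemLp (fun ξ : ℝ => Complex.exp (-(2 * Real.pi * Complex.I * a * ξ)) * g ξ) 2 volume := by
  refine (Lp.memLp g).of_le (.mul (Continuous.aestronglyMeasurable (by fun_prop))
    (Lp.aestronglyMeasurable g)) (Eventually.of_forall fun ξ => ?_)
  rw [norm_mul, Complex.norm_exp]
  simp

/-- Both sides depend continuously on `B`, the right one because multiplication by a unimodular
function is an isometry of `L₂`. So it suffices to compare them on the dense set of Schwartz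
functions, where the transform is an integral. -/
theorem fourier_shift (a : ℝ) (B : L2R ℂ) : ∀ᵐ ξ : ℝ, (𝓕 (shift a B) : L2R ℂ) ξ =
    Complex.exp (-(2 * Real.pi * Complex.I * a * ξ)) * (𝓕 B : L2R ℂ) ξ := by
  set N : L2R ℂ → L2R ℂ := fun g => (memLp_exp_mul a g).toLp _ with hN
  have hNi : Isometry N := by
    refine Isometry.of_dist_eq fun g h => ?_
    rw [Lp.dist_def, Lp.dist_def]
    congr 1
    refine eLpNorm_congr_norm_ae ?_
    filter_upwards [(memLp_exp_mul a g).coeFn_toLp, (memLp_exp_mul a h).coeFn_toLp] with ξ h1 h2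
    simp only [Pi.sub_apply, hN, h1, h2, ← mul_sub, norm_mul, Complex.norm_exp]
    simp
  have hF : Continuous fun B : L2R ℂ => (𝓕 B : L2R ℂ) := (Lp.fourierTransformₗᵢ ℝ ℂ).continuous
  have hS : Continuous fun B : L2R ℂ => shift a B :=
    (Lp.isometry_compMeasurePreserving (measurePreserving_sub_right volume a)).continuous
  have key : (fun B : L2R ℂ => (𝓕 (shift a B) : L2R ℂ)) = fun B => N (𝓕 B) := by
    refine DenseRange.equalizer (SchwartzMap.denseRange_toLpCLM (F := ℂ) (E := ℝ) (p := 2)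
      (μ := volume) ENNReal.ofNat_ne_top) (hF.comp hS) (hNi.continuous.comp hF) ?_
    ext1 φ
    simp only [Function.comp_apply, SchwartzMap.toLpCLM_apply]
    have h1 : shift a (φ.toLp 2) = (φ.compSubConstCLM ℂ a).toLp 2 := by
      refine Lp.ext ?_
      filter_upwards [shift_coeFn a (φ.toLp 2 (volume : Measure ℝ)),
        (measurePreserving_sub_right volume a).quasiMeasurePreserving.ae_eq_comp
          (φ.coeFn_toLp 2 (volume : Measure ℝ)),
        (φ.compSubConstCLM ℂ a).coeFn_toLp 2 (volume : Measure ℝ)] with x h1 h2 h3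
      rw [h1, h3]
      exact h2
    rw [h1, SchwartzMap.toLp_fourier_eq, SchwartzMap.toLp_fourier_eq]
    refine Lp.ext ?_
    filter_upwards [(𝓕 (φ.compSubConstCLM ℂ a)).coeFn_toLp 2 (volume : Measure ℝ),
      (𝓕 φ).coeFn_toLp 2 (volume : Measure ℝ),
      (memLp_exp_mul a ((𝓕 φ).toLp 2)).coeFn_toLp] with ξ h1 h2 h3
    simp only [hN]
    rw [h1, h3, h2, fourier_compSubConst]
  rw [show (𝓕 (shift a B) : L2R ℂ) = N (𝓕 B) from congrFun key B]
  exact (memLp_exp_mul a _).coeFn_toLp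

theorem hat_shift (a : ℝ) (B : L2R ℂ) :
    ∀ᵐ y : ℝ, hat (shift a B) y = Complex.exp (-(Complex.I * (a * y : ℝ))) * hat B y := by
  filter_upwards [hat_congr_of_fourier (fourier_shift a B)] with y hy
  rw [hy, hat_complex]
  have : (Real.pi : ℂ) ≠ 0 := by exact_mod_cast Real.pi_ne_zero
  have h2 : -(2 * Real.pi * Complex.I * a * ((y / (2 * Real.pi) : ℝ) : ℂ)) =
      -(Complex.I * ((a * y : ℝ) : ℂ)) := by
    push_cast
    field_simp
  rw [h2]
  ring

end HatShift

/-! ### Splitting the line into translates of `[-σ, σ]` -/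

section Periodization

theorem mu_eq_restrict_Ioc (σ : ℝ) : mu σ = volume.restrict (Set.Ioc (-σ) (-σ + 2 * σ)) := by
  rw [show -σ + 2 * σ = σ by ring]
  exact (Measure.restrict_congr_set Ioc_ae_eq_Icc).symm

/-- Integers as the multiples of a positive number. -/
def intEquivZMultiples {T : ℝ} (hT : 0 < T) : ℤ ≃ AddSubgroup.zmultiples T :=
  Equiv.ofBijective (fun k => ⟨k • T, k, rfl⟩)
    ⟨fun _ _ h => (zsmul_left_strictMono hT).injective (congrArg Subtype.val h),
      fun ⟨_, k, hk⟩ => ⟨k, Subtype.ext hk⟩⟩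

theorem intEquivZMultiples_vadd {σ : ℝ} (hσ : 0 < 2 * σ) (k : ℤ) (y : ℝ) :
    intEquivZMultiples hσ k +ᵥ y = y + 2 * k * σ := by
  change (k • (2 * σ) : ℝ) + y = _
  rw [zsmul_eq_mul]
  ring

theorem lintegral_eq_tsum_lintegral_mu {σ : ℝ} (hσ : 0 < σ) (g : ℝ → ℝ≥0∞) :
    ∫⁻ y : ℝ, g y = ∑' k : ℤ, ∫⁻ y, g (y + 2 * k * σ) ∂(mu σ) := by
  have hT : 0 < 2 * σ := by positivity
  rw [(isAddFundamentalDomain_Ioc hT (-σ) volume).lintegral_eq_tsum'' g, mu_eq_restrict_Ioc,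
    ← (intEquivZMultiples hT).tsum_eq]
  simp_rw [intEquivZMultiples_vadd]

theorem integral_eq_tsum_integral_mu {σ : ℝ} (hσ : 0 < σ) {g : ℝ → ℂ} (hg : Integrable g) :
    ∫ y : ℝ, g y = ∑' k : ℤ, ∫ y, g (y + 2 * k * σ) ∂(mu σ) := by
  have hT : 0 < 2 * σ := by positivity
  rw [(isAddFundamentalDomain_Ioc hT (-σ) volume).integral_eq_tsum'' g hg, mu_eq_restrict_Ioc,
    ← (intEquivZMultiples hT).tsum_eq]
  simp_rw [intEquivZMultiples_vadd]

theorem quasiMeasurePreserving_add_mu (σ a : ℝ) :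
    Measure.QuasiMeasurePreserving (fun y : ℝ => y + a) (mu σ) volume :=
  (measurePreserving_add_right volume a).quasiMeasurePreserving.mono_left
    Measure.absolutelyContinuous_restrict

theorem ae_mu_forall_add {σ : ℝ} {p : ℝ → Prop} (h : ∀ᵐ y : ℝ, p y) :
    ∀ᵐ y ∂(mu σ), ∀ k : ℤ, p (y + 2 * k * σ) :=
  ae_all_iff.2 fun k => (quasiMeasurePreserving_add_mu σ (2 * k * σ)).ae h

/-- The exceptional set is invariant under translations by `2σℤ` and is null on a fundamental
domain, hence null. -/
theorem ae_of_ae_mu_of_periodic {σ : ℝ} (hσ : 0 < σ) {p : ℝ → Prop}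
    (hp : ∀ (k : ℤ) (y : ℝ), p (y + 2 * k * σ) ↔ p y) (h : ∀ᵐ y ∂(mu σ), p y) : ∀ᵐ y : ℝ, p y := by
  have hT : 0 < 2 * σ := by positivity
  rw [ae_iff]
  refine (isAddFundamentalDomain_Ioc hT (-σ) volume).measure_zero_of_invariant {y | ¬ p y} ?_ ?_
  · intro g
    obtain ⟨k, rfl⟩ := (intEquivZMultiples hT).surjective g
    ext y
    rw [Set.mem_vadd_set_iff_neg_vadd_mem]
    have : y = (-(intEquivZMultiples hT k) +ᵥ y) + 2 * k * σ := by
      rw [← intEquivZMultiples_vadd hT, vadd_neg_vadd]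
    rw [Set.mem_ofPred_eq, Set.mem_ofPred_eq]
    conv_rhs => rw [this]
    rw [hp]
  · rw [mu_eq_restrict_Ioc, ae_iff, Measure.restrict_apply₀' nullMeasurableSet_Ioc] at h
    exact h

theorem lintegral_eq_lintegral_mu_tsum {σ : ℝ} (hσ : 0 < σ) {g : ℝ → ℝ≥0∞}
    (hg : AEMeasurable g) :
    ∫⁻ y : ℝ, g y = ∫⁻ y, ∑' k : ℤ, g (y + 2 * k * σ) ∂(mu σ) := by
  have hm (k : ℤ) : AEMeasurable (fun y => g (y + 2 * k * σ)) (mu σ) :=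
    hg.comp_quasiMeasurePreserving (quasiMeasurePreserving_add_mu σ (2 * k * σ))
  rw [lintegral_eq_tsum_lintegral_mu hσ, lintegral_tsum hm]

theorem tsum_shift_two_mul {α : Type*} [AddCommMonoid α] [TopologicalSpace α] [T2Space α] (σ : ℝ)
    (g : ℝ → α) (m : ℤ) (y : ℝ) :
    ∑' k : ℤ, g (y + 2 * m * σ + 2 * k * σ) = ∑' k : ℤ, g (y + 2 * k * σ) := by
  rw [← (Equiv.addLeft m).tsum_eq fun k : ℤ => g (y + 2 * k * σ)]
  refine tsum_congr fun k => congrArg g ?_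
  simp only [Equiv.coe_addLeft, Int.cast_add]
  ring

theorem summable_shift_two_mul {α : Type*} [AddCommMonoid α] [TopologicalSpace α] (σ : ℝ)
    (g : ℝ → α) (m : ℤ) (y : ℝ) :
    (Summable fun k : ℤ => g (y + 2 * m * σ + 2 * k * σ)) ↔
      Summable fun k : ℤ => g (y + 2 * k * σ) := by
  rw [← (Equiv.addLeft m).summable_iff (f := fun k : ℤ => g (y + 2 * k * σ))]
  refine Eq.to_iff (congrArg (fun h => Summable h) (funext fun k => congrArg g ?_))
  simp only [Equiv.coe_addLeft, Int.cast_add]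
  ring

end Periodization

/-! ### Least squares in one fibre -/

section SquareSummable

variable {u v : ℤ → ℂ}

/-- A square-summable family as an element of `ℓ₂`. -/
def toEllTwo (u : ℤ → ℂ) (hu : Summable fun k => ‖u k‖ ^ 2) : lp (fun _ : ℤ => ℂ) 2 :=
  ⟨u, memℓp_gen (by simpa using hu)⟩

theorem norm_sq_toEllTwo (hu : Summable fun k => ‖u k‖ ^ 2) :
    ‖toEllTwo u hu‖ ^ 2 = ∑' k, ‖u k‖ ^ 2 := by
  have := lp.norm_rpow_eq_tsum (p := 2) (by norm_num) (toEllTwo u hu)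
  simpa [toEllTwo] using this

theorem hasSum_inner_toEllTwo (hu : Summable fun k => ‖u k‖ ^ 2)
    (hv : Summable fun k => ‖v k‖ ^ 2) :
    HasSum (fun k => (starRingEnd ℂ) (u k) * v k) (inner ℂ (toEllTwo u hu) (toEllTwo v hv)) := by
  have := lp.hasSum_inner (𝕜 := ℂ) (toEllTwo u hu) (toEllTwo v hv)
  simpa [toEllTwo, mul_comm] using this

theorem summable_conj_mul (hu : Summable fun k => ‖u k‖ ^ 2) (hv : Summable fun k => ‖v k‖ ^ 2) :
    Summable fun k => (starRingEnd ℂ) (u k) * v k :=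
  (hasSum_inner_toEllTwo hu hv).summable

theorem norm_tsum_conj_mul_sq_le (hu : Summable fun k => ‖u k‖ ^ 2)
    (hv : Summable fun k => ‖v k‖ ^ 2) :
    ‖∑' k, (starRingEnd ℂ) (u k) * v k‖ ^ 2 ≤ (∑' k, ‖u k‖ ^ 2) * ∑' k, ‖v k‖ ^ 2 := by
  rw [(hasSum_inner_toEllTwo hu hv).tsum_eq, ← norm_sq_toEllTwo hu, ← norm_sq_toEllTwo hv,
    ← mul_pow]
  gcongr
  exact norm_inner_le_norm _ _

/-- Completion of the square for the distance in `ℓ₂` from `v` to a point `S u` of the line spanned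
by `u`. -/
theorem tsum_norm_sub_mul_sq (hu : Summable fun k => ‖u k‖ ^ 2)
    (hv : Summable fun k => ‖v k‖ ^ 2) (S : ℂ) (hD : 0 < ∑' k, ‖u k‖ ^ 2) :
    HasSum (fun k => ‖v k - S * u k‖ ^ 2)
      (∑' k, ‖v k‖ ^ 2 - 1 / (∑' k, ‖u k‖ ^ 2) * ‖∑' k, (starRingEnd ℂ) (u k) * v k‖ ^ 2 +
        (∑' k, ‖u k‖ ^ 2) *
          ‖S - (1 / (∑' k, ‖u k‖ ^ 2 : ℝ) : ℂ) * ∑' k, (starRingEnd ℂ) (u k) * v k‖ ^ 2) := by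
  set x := toEllTwo u hu with hx
  set z := toEllTwo v hv with hz
  have h := lp.hasSum_norm (p := 2) (by norm_num) (z - S • x)
  have h' : HasSum (fun k => ‖v k - S * u k‖ ^ 2) (‖z - S • x‖ ^ 2) := by
    have he : ∀ k, (z - S • x : lp (fun _ : ℤ => ℂ) 2) k = v k - S * u k := fun k => rfl
    simpa [he] using h
  convert h' using 1
  rw [← norm_sq_toEllTwo hu, ← norm_sq_toEllTwo hv, (hasSum_inner_toEllTwo hu hv).tsum_eq,
    ← hx, ← hz]
  rw [← norm_sq_toEllTwo hu, ← hx] at hD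
  set c := inner ℂ x z with hc
  set d := ‖x‖ ^ 2 with hd
  rw [@norm_sub_sq ℂ _ _ _ _ z (S • x), norm_smul, mul_pow, inner_smul_right, ← inner_conj_symm, ← hc, ← hd]
  rw [Complex.sq_norm, Complex.sq_norm, Complex.sq_norm, Complex.normSq_apply,
    Complex.normSq_apply, Complex.normSq_apply]
  have hq : (1 / (d : ℂ)) = ((1 / d : ℝ) : ℂ) := by push_cast; rfl
  rw [hq]
  simp only [Complex.sub_re, Complex.sub_im, Complex.mul_re, Complex.mul_im, Complex.ofReal_re,
    Complex.ofReal_im, RCLike.re_eq_complex_re, Complex.conj_re, Complex.conj_im]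
  field_simp
  ring

end SquareSummable

/-! ### Exponentials as an orthogonal basis of `L₂[-σ, σ]` -/

section TrigBasis

theorem trig_coeFn (σ : ℝ) (j : ℤ) : ∀ᵐ y ∂(mu σ), trig σ j y = trigFun σ j y :=
  (memLp_trigFun σ j).coeFn_toLp

theorem conj_trigFun (σ : ℝ) (j : ℤ) (y : ℝ) :
    (starRingEnd ℂ) (trigFun σ j y) = trigFun σ (-j) y := by
  rw [trigFun, trigFun, ← Complex.exp_conj]
  congr 1
  simp only [map_mul, Complex.conj_I, Complex.conj_ofReal]
  push_cast
  ring

theorem trigFun_add (σ : ℝ) (j k : ℤ) (y : ℝ) :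
    trigFun σ (j + k) y = trigFun σ j y * trigFun σ k y := by
  rw [trigFun, trigFun, trigFun, ← Complex.exp_add]
  congr 1
  push_cast
  ring

theorem trigFun_add_two_mul {σ : ℝ} (hσ : 0 < σ) (j k : ℤ) (y : ℝ) :
    trigFun σ j (y + 2 * k * σ) = trigFun σ j y := by
  rw [trigFun, trigFun, Complex.exp_eq_exp_iff_exists_int]
  refine ⟨j * k, ?_⟩
  have : (σ : ℂ) ≠ 0 := by exact_mod_cast hσ.ne'
  push_cast
  field_simp

theorem integral_mu_eq_intervalIntegral {σ : ℝ} (hσ : 0 < σ) {E : Type*} [NormedAddCommGroup E]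
    [NormedSpace ℝ E] (g : ℝ → E) : ∫ y, g y ∂(mu σ) = ∫ y in (-σ)..σ, g y := by
  rw [intervalIntegral.integral_of_le (by linarith), integral_Icc_eq_integral_Ioc]

theorem integral_trigFun {σ : ℝ} (hσ : 0 < σ) (j : ℤ) :
    ∫ y, trigFun σ j y ∂(mu σ) = if j = 0 then ((2 * σ : ℝ) : ℂ) else 0 := by
  rw [integral_mu_eq_intervalIntegral hσ]
  have hs : (σ : ℂ) ≠ 0 := by exact_mod_cast hσ.ne'
  split_ifs with hj
  · subst hj
    simp only [trigFun]
    norm_num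
    ring
  · have hj' : (j : ℂ) ≠ 0 := by exact_mod_cast hj
    have hp : (Real.pi : ℂ) ≠ 0 := by exact_mod_cast Real.pi_ne_zero
    have hc : Complex.I * (j * Real.pi / σ) ≠ 0 := by
      simp [hj', hp, hs, Complex.I_ne_zero]
    have h1 : ∀ y : ℝ, trigFun σ j y = Complex.exp (Complex.I * (j * Real.pi / σ) * y) := by
      intro y
      rw [trigFun]
      congr 1
      push_cast
      ring
    simp_rw [h1]
    rw [integral_exp_mul_complex hc]
    -- The endpoints differ by one period, so the antiderivative takes equal values there.
    have h2 := h1 (-σ + 2 * (1 : ℤ) * σ)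
    rw [trigFun_add_two_mul hσ, h1] at h2
    rw [show ((-σ + 2 * (1 : ℤ) * σ : ℝ) : ℂ) = (σ : ℂ) by push_cast; ring] at h2
    rw [h2, sub_self, zero_div]

theorem inner_trig_eq_integral (σ : ℝ) (j : ℤ) (g : L2I σ) :
    inner ℂ (trig σ j) g = ∫ y, trigFun σ (-j) y * g y ∂(mu σ) := by
  rw [L2.inner_def]
  refine integral_congr_ae ?_
  filter_upwards [trig_coeFn σ j] with y hy
  rw [hy, RCLike.inner_apply, conj_trigFun, mul_comm]

theorem inner_trig_trig {σ : ℝ} (hσ : 0 < σ) (j k : ℤ) :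
    inner ℂ (trig σ j) (trig σ k) = if j = k then ((2 * σ : ℝ) : ℂ) else 0 := by
  rw [inner_trig_eq_integral]
  have : ∫ y, trigFun σ (-j) y * trig σ k y ∂(mu σ) = ∫ y, trigFun σ (-j + k) y ∂(mu σ) := by
    refine integral_congr_ae ?_
    filter_upwards [trig_coeFn σ k] with y hy
    rw [hy, trigFun_add]
  rw [this, integral_trigFun hσ]
  refine if_congr ?_ rfl rfl
  omega

/-- The inner products are, up to a factor, the Fourier coefficients of `g` on an interval of length
`2σ`; Parseval then makes `∫ |g|²` vanish. -/
theorem eq_zero_of_inner_trig_eq_zero {σ : ℝ} (hσ : 0 < σ) {g : L2I σ}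
    (h : ∀ j, inner ℂ (trig σ j) g = 0) : g = 0 := by
  have hab : -σ < σ := by linarith
  have hL : MemLp g 2 (volume.restrict (Set.Ioc (-σ) σ)) := by
    rw [Measure.restrict_congr_set Ioc_ae_eq_Icc]
    exact Lp.memLp g
  have hs := hasSum_sq_fourierCoeffOn hab hL
  have hc : ∀ j, fourierCoeffOn hab g j = 0 := by
    intro j
    rw [fourierCoeffOn_eq_integral]
    have : ∫ x in (-σ)..σ, fourier (-j) (x : AddCircle (σ - -σ)) • g x = 0 := by
      rw [← h j, inner_trig_eq_integral, integral_mu_eq_intervalIntegral hσ]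
      refine intervalIntegral.integral_congr fun x _ => ?_
      simp only [smul_eq_mul]
      rw [fourier_coe_apply, trigFun]
      congr 2
      have : (σ : ℂ) ≠ 0 := by exact_mod_cast hσ.ne'
      have h2 : (σ : ℂ) - -σ ≠ 0 := by
        rw [sub_neg_eq_add, ← two_mul]
        exact mul_ne_zero two_ne_zero this
      push_cast
      field_simp
      ring
    rw [this, smul_zero]
  simp only [hc, norm_zero, ne_eq, OfNat.ofNat_ne_zero, not_false_eq_true, zero_pow] at hs
  have h0 := hs.unique hasSum_zero
  rw [smul_eq_zero] at h0
  have h1 : ∫ x in (-σ)..σ, ‖g x‖ ^ 2 = 0 := h0.resolve_left (by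
    rw [inv_eq_zero]
    linarith)
  rw [← integral_mu_eq_intervalIntegral hσ] at h1
  rw [← inner_self_eq_zero (𝕜 := ℂ), L2.inner_def]
  have h2 : ∀ x, inner ℂ (g x) (g x) = ((‖g x‖ ^ 2 : ℝ) : ℂ) := fun x => by
    rw [inner_self_eq_norm_sq_to_K]
    norm_cast
  simp_rw [h2]
  rw [integral_complex_ofReal, h1, Complex.ofReal_zero]

/-- The tool for identities in `L₂[-σ, σ]`: comparing coefficients avoids pointwise work with
representatives. -/
theorem ext_inner_trig {σ : ℝ} (hσ : 0 < σ) {g h : L2I σ}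
    (H : ∀ j, inner ℂ (trig σ (-j)) g = inner ℂ (trig σ (-j)) h) : g = h := by
  rw [← sub_eq_zero]
  refine eq_zero_of_inner_trig_eq_zero hσ fun j => ?_
  rw [inner_sub_right, sub_eq_zero]
  simpa using H (-j)

theorem orthonormal_trig {σ : ℝ} (hσ : 0 < σ) :
    Orthonormal ℂ fun j : ℤ => ((1 / Real.sqrt (2 * σ) : ℝ) : ℂ) • trig σ (-j) := by
  rw [orthonormal_iff_ite]
  intro i j
  have h2 : (0 : ℝ) < 2 * σ := by positivity
  rw [inner_smul_left, inner_smul_right, inner_trig_trig hσ, Complex.conj_ofReal]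
  simp only [neg_inj]
  split_ifs
  · norm_cast
    rw [← mul_assoc, div_mul_div_comm, Real.mul_self_sqrt h2.le, mul_one, one_div,
      inv_mul_cancel₀ h2.ne']
  · simp

/-- The normalized exponentials `exp(-i j π y / σ) / √(2σ)` as a Hilbert basis of `L₂[-σ, σ]`. -/
def trigBasis {σ : ℝ} (hσ : 0 < σ) : HilbertBasis ℤ ℂ (L2I σ) :=
  HilbertBasis.mkOfOrthogonalEqBot (orthonormal_trig hσ) (by
    rw [Submodule.eq_bot_iff]
    intro g hg
    refine eq_zero_of_inner_trig_eq_zero hσ fun j => ?_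
    have h := (Submodule.mem_orthogonal _ _).1 hg _ (Submodule.subset_span ⟨-j, rfl⟩)
    rw [inner_smul_left, neg_neg, mul_eq_zero] at h
    refine h.resolve_left ?_
    rw [Complex.conj_ofReal]
    exact Complex.ofReal_ne_zero.2 (by positivity))

theorem trigBasis_apply {σ : ℝ} (hσ : 0 < σ) (j : ℤ) :
    trigBasis hσ j = ((1 / Real.sqrt (2 * σ) : ℝ) : ℂ) • trig σ (-j) := by
  rw [trigBasis, HilbertBasis.coe_mkOfOrthogonalEqBot]

theorem hasSum_trigSeries {σ : ℝ} (hσ : 0 < σ) (β : lp (fun _ : ℤ => ℂ) 2) :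
    HasSum (fun j : ℤ => β j • trig σ (-j))
      (((Real.sqrt (2 * σ) : ℝ) : ℂ) • (trigBasis hσ).repr.symm β) := by
  have h := ((trigBasis hσ).hasSum_repr_symm β).const_smul ((Real.sqrt (2 * σ) : ℝ) : ℂ)
  convert h using 2 with j
  have h2 : ((Real.sqrt (2 * σ) : ℝ) : ℂ) ≠ 0 := by
    rw [Complex.ofReal_ne_zero]
    positivity
  rw [trigBasis_apply, smul_smul, smul_smul]
  congr 1
  push_cast
  field_simp

theorem trigSeries_eq {σ : ℝ} (hσ : 0 < σ) (β : lp (fun _ : ℤ => ℂ) 2) :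
    trigSeries σ β = ((Real.sqrt (2 * σ) : ℝ) : ℂ) • (trigBasis hσ).repr.symm β := by
  rw [trigSeries]
  simp_rw [toC_complex]
  exact (hasSum_trigSeries hσ β).tsum_eq

theorem hasSum_trigSeries' {σ : ℝ} (hσ : 0 < σ) (β : lp (fun _ : ℤ => ℂ) 2) :
    HasSum (fun j : ℤ => β j • trig σ (-j)) (trigSeries σ β) := by
  rw [trigSeries_eq hσ]
  exact hasSum_trigSeries hσ β

theorem norm_sq_trigSeries {σ : ℝ} (hσ : 0 < σ) (β : lp (fun _ : ℤ => ℂ) 2) :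
    ‖trigSeries σ β‖ ^ 2 = 2 * σ * ‖β‖ ^ 2 := by
  rw [trigSeries_eq hσ, norm_smul, LinearIsometryEquiv.norm_map, mul_pow, Complex.norm_real,
    Real.norm_of_nonneg (Real.sqrt_nonneg _), Real.sq_sqrt (by positivity)]

theorem exists_trigSeries_eq {σ : ℝ} (hσ : 0 < σ) (S : L2I σ) :
    ∃ β : lp (fun _ : ℤ => ℂ) 2, trigSeries σ β = S := by
  refine ⟨((1 / Real.sqrt (2 * σ) : ℝ) : ℂ) • (trigBasis hσ).repr S, ?_⟩
  have h2 : ((Real.sqrt (2 * σ) : ℝ) : ℂ) ≠ 0 := by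
    rw [Complex.ofReal_ne_zero]
    positivity
  rw [trigSeries_eq hσ, map_smul, LinearIsometryEquiv.symm_apply_apply, smul_smul]
  push_cast
  rw [mul_one_div_cancel h2, one_smul]

end TrigBasis

/-! ### Series of shifts on the Fourier side -/

section Synthesis

theorem exp_neg_eq_trigFun (σ : ℝ) (j : ℤ) (y : ℝ) :
    Complex.exp (-(Complex.I * ((j * Real.pi / σ * y : ℝ) : ℂ))) = trigFun σ (-j) y := by
  rw [trigFun]
  congr 1
  push_cast
  ring

theorem hat_partial_sum (σ : ℝ) (B : L2R ℂ) (β : ℤ → ℂ) (K : Finset ℤ) :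
    ∀ᵐ y : ℝ, hat (∑ j ∈ K, β j • shift (j * Real.pi / σ) B) y =
      (∑ j ∈ K, β j * trigFun σ (-j) y) * hat B y := by
  have h1 : ∀ᵐ y : ℝ, ∀ j : ℤ, hat (β j • shift (j * Real.pi / σ) B) y =
      β j * trigFun σ (-j) y * hat B y := by
    refine ae_all_iff.2 fun j => ?_
    filter_upwards [hat_smul (β j) (shift (j * Real.pi / σ) B), hat_shift (j * Real.pi / σ) B]
      with y h1 h2
    rw [h1, h2, exp_neg_eq_trigFun, mul_assoc]
  filter_upwards [h1, hat_sum K fun j => β j • shift (j * Real.pi / σ) B] with y h1 h2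
  rw [h2, Finset.sum_mul]
  exact Finset.sum_congr rfl fun j _ => h1 j

theorem trig_partial_sum (σ : ℝ) (β : ℤ → ℂ) (K : Finset ℤ) :
    ∀ᵐ y ∂(mu σ), (∑ j ∈ K, β j • trig σ (-j) : L2I σ) y = ∑ j ∈ K, β j * trigFun σ (-j) y := by
  have h1 : ∀ᵐ y ∂(mu σ), ∀ j : ℤ, (β j • trig σ (-j) : L2I σ) y = β j * trigFun σ (-j) y := by
    refine ae_all_iff.2 fun j => ?_
    filter_upwards [Lp.coeFn_smul (β j) (trig σ (-j)), trig_coeFn σ (-j)] with y h1 h2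
    rw [h1, Pi.smul_apply, h2, smul_eq_mul]
  filter_upwards [h1, Lp.coeFn_finsetSum K fun j => (β j • trig σ (-j) : L2I σ)] with y h1 h2
  rw [h2, Finset.sum_apply]
  exact Finset.sum_congr rfl fun j _ => h1 j

/-- Exact for finite sums, since the exponentials have period `2σ`. Both sides converge in `L₂`,
hence a.e. along a common sequence of finite index sets, and limits are unique. -/
theorem hat_eq_trigSeries_mul {σ : ℝ} (hσ : 0 < σ) (B : L2R ℂ) (β : lp (fun _ : ℤ => ℂ) 2)
    {s : L2R ℂ} (hs : HasSum (fun j : ℤ => β j • shift (j * Real.pi / σ) B) s) :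
    ∀ᵐ y ∂(mu σ), ∀ k : ℤ,
      hat s (y + 2 * k * σ) = trigSeries σ β y * hat B (y + 2 * k * σ) := by
  obtain ⟨ns, hns, h1⟩ :=
    (tendstoInMeasure_of_tendsto_Lp (hasSum_trigSeries' hσ β)).exists_seq_tendsto_ae'
  have hF : Continuous fun B : L2R ℂ => (𝓕 B : L2R ℂ) := (Lp.fourierTransformₗᵢ ℝ ℂ).continuous
  have hs' : Tendsto (fun K : Finset ℤ => ∑ j ∈ K, β j • shift (j * Real.pi / σ) B)
      (SummationFilter.unconditional ℤ).filter (𝓝 s) := hs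
  have h2 : Tendsto (fun i => (𝓕 (∑ j ∈ ns i, β j • shift (j * Real.pi / σ) B) : L2R ℂ)) atTop
      (𝓝 (𝓕 s)) := (hF.tendsto s).comp (hs'.comp hns)
  -- A further subsequence: convergence of the trigonometric sums persists along it.
  obtain ⟨ms, hms, h3⟩ := (tendstoInMeasure_of_tendsto_Lp h2).exists_seq_tendsto_ae'
  have h4 := ae_mu_forall_add (σ := σ) (quasiMeasurePreserving_div_two_pi.ae h3)
  have h5 := ae_mu_forall_add (σ := σ) (ae_all_iff.2 fun i => hat_partial_sum σ B β (ns (ms i)))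
  have h6 := ae_all_iff.2 fun i => trig_partial_sum σ β (ns (ms i))
  filter_upwards [h1, h4, h5, h6] with y h1 h4 h5 h6 k
  have e1 : Tendsto (fun i => hat (∑ j ∈ ns (ms i), β j • shift (j * Real.pi / σ) B)
      (y + 2 * k * σ)) atTop (𝓝 (hat s (y + 2 * k * σ))) := by
    simp_rw [hat_complex]
    exact (h4 k).const_mul _
  have e2 : Tendsto (fun i => hat (∑ j ∈ ns (ms i), β j • shift (j * Real.pi / σ) B)
      (y + 2 * k * σ)) atTop (𝓝 (trigSeries σ β y * hat B (y + 2 * k * σ))) := by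
    have e3 : ∀ i, hat (∑ j ∈ ns (ms i), β j • shift (j * Real.pi / σ) B) (y + 2 * k * σ) =
        (∑ j ∈ ns (ms i), β j • trig σ (-j) : L2I σ) y * hat B (y + 2 * k * σ) := by
      intro i
      rw [h5 k i, h6 i]
      simp_rw [trigFun_add_two_mul hσ]
    simp_rw [e3]
    exact (h1.comp hms).mul_const _
  exact tendsto_nhds_unique e1 e2

end Synthesis

/-! ### The periodized square `D` -/

section PeriodizedSquare

variable {σ : ℝ}

theorem aemeasurable_enorm_hat_sq (f : L2R ℂ) : AEMeasurable (fun y => ‖hat f y‖ₑ ^ 2) :=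
  (aestronglyMeasurable_hat f).enorm.pow_const 2

theorem aemeasurable_mu_enorm_hat_sq (σ : ℝ) (f : L2R ℂ) (k : ℤ) :
    AEMeasurable (fun y => ‖hat f (y + 2 * k * σ)‖ₑ ^ 2) (mu σ) :=
  (aemeasurable_enorm_hat_sq f).comp_quasiMeasurePreserving (quasiMeasurePreserving_add_mu σ _)

theorem aestronglyMeasurable_hat_add (σ : ℝ) (f : L2R ℂ) (k : ℤ) :
    AEStronglyMeasurable (fun y => hat f (y + 2 * k * σ)) (mu σ) :=
  (aestronglyMeasurable_hat f).comp_quasiMeasurePreserving (quasiMeasurePreserving_add_mu σ _)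

/-- Valid at every `y`: where the series diverges, both sides take the default value `0`. -/
theorem D_eq_toReal (f : L2R ℂ) (y : ℝ) :
    D f σ y = (∑' k : ℤ, ‖hat f (y + 2 * k * σ)‖ₑ ^ 2).toReal := by
  rw [ENNReal.tsum_toReal_eq fun k => by finiteness, D]
  simp

theorem D_nonneg (f : L2R ℂ) (y : ℝ) : 0 ≤ D f σ y := tsum_nonneg fun _ => by positivity

theorem lintegral_mu_tsum_hat_sq (hσ : 0 < σ) (f : L2R ℂ) :
    ∫⁻ y, ∑' k : ℤ, ‖hat f (y + 2 * k * σ)‖ₑ ^ 2 ∂(mu σ) =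
      ENNReal.ofReal (‖f‖ ^ 2 / (2 * Real.pi)) := by
  rw [← lintegral_hat, lintegral_eq_lintegral_mu_tsum hσ (aemeasurable_enorm_hat_sq f)]

theorem ae_mu_tsum_hat_sq_lt_top (hσ : 0 < σ) (f : L2R ℂ) :
    ∀ᵐ y ∂(mu σ), ∑' k : ℤ, ‖hat f (y + 2 * k * σ)‖ₑ ^ 2 < ∞ := by
  refine ae_lt_top' (AEMeasurable.tsum fun k => aemeasurable_mu_enorm_hat_sq σ f k) ?_
  rw [lintegral_mu_tsum_hat_sq hσ]
  exact ENNReal.ofReal_ne_top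

theorem ae_summable_hat_sq (hσ : 0 < σ) (f : L2R ℂ) :
    ∀ᵐ y : ℝ, Summable fun k : ℤ => ‖hat f (y + 2 * k * σ)‖ ^ 2 := by
  refine ae_of_ae_mu_of_periodic hσ
    (fun m y => summable_shift_two_mul σ (fun y => ‖hat f y‖ ^ 2) m y) ?_
  filter_upwards [ae_mu_tsum_hat_sq_lt_top hσ f] with y hy
  simpa using ENNReal.summable_toReal hy.ne

theorem ae_mu_ofReal_D (hσ : 0 < σ) (f : L2R ℂ) :
    ∀ᵐ y ∂(mu σ), ENNReal.ofReal (D f σ y) = ∑' k : ℤ, ‖hat f (y + 2 * k * σ)‖ₑ ^ 2 := by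
  filter_upwards [ae_mu_tsum_hat_sq_lt_top hσ f] with y hy
  rw [D_eq_toReal, ENNReal.ofReal_toReal hy.ne]

theorem lintegral_mu_D (hσ : 0 < σ) (f : L2R ℂ) :
    ∫⁻ y, ENNReal.ofReal (D f σ y) ∂(mu σ) = ENNReal.ofReal (‖f‖ ^ 2 / (2 * Real.pi)) := by
  rw [lintegral_congr_ae (ae_mu_ofReal_D hσ f), lintegral_mu_tsum_hat_sq hσ]

theorem aemeasurable_mu_D (σ : ℝ) (f : L2R ℂ) : AEMeasurable (D f σ) (mu σ) := by
  rw [funext (D_eq_toReal f)]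
  exact (AEMeasurable.tsum fun k => aemeasurable_mu_enorm_hat_sq σ f k).ennreal_toReal

theorem integrable_mu_D (hσ : 0 < σ) (f : L2R ℂ) : Integrable (D f σ) (mu σ) := by
  refine ⟨(aemeasurable_mu_D σ f).aestronglyMeasurable, ?_⟩
  rw [hasFiniteIntegral_iff_ofReal (Eventually.of_forall (D_nonneg f)), lintegral_mu_D hσ]
  exact ENNReal.ofReal_lt_top

theorem integral_mu_D (hσ : 0 < σ) (f : L2R ℂ) :
    ∫ y, D f σ y ∂(mu σ) = ‖f‖ ^ 2 / (2 * Real.pi) := by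
  rw [integral_eq_lintegral_of_nonneg_ae (Eventually.of_forall (D_nonneg f))
    (aemeasurable_mu_D σ f).aestronglyMeasurable, lintegral_mu_D hσ,
    ENNReal.toReal_ofReal (by positivity)]

theorem D_add_two_mul (f : L2R ℂ) (m : ℤ) (y : ℝ) : D f σ (y + 2 * m * σ) = D f σ y :=
  tsum_shift_two_mul σ (fun y => ‖hat f y‖ ^ 2) m y

end PeriodizedSquare

/-! ### Riesz bounds as pointwise bounds on `D` -/

section RieszBounds

variable {σ : ℝ}

theorem lintegral_trigSeries_sq_mul (hσ : 0 < σ) (B : L2R ℂ) (β : lp (fun _ : ℤ => ℂ) 2)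
    {s : L2R ℂ} (hs : HasSum (fun j : ℤ => β j • shift (j * Real.pi / σ) B) s) :
    ∫⁻ y, ‖trigSeries σ β y‖ₑ ^ 2 * ENNReal.ofReal (D B σ y) ∂(mu σ) =
      ENNReal.ofReal (‖s‖ ^ 2 / (2 * Real.pi)) := by
  rw [← lintegral_mu_tsum_hat_sq hσ]
  refine lintegral_congr_ae ?_
  filter_upwards [hat_eq_trigSeries_mul hσ B β hs, ae_mu_ofReal_D hσ B] with y h1 h2
  rw [h2, ← ENNReal.tsum_mul_left]
  refine tsum_congr fun k => ?_
  rw [h1, enorm_mul, mul_pow]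

/-- The indicator of a measurable set as an element of `L₂[-σ, σ]`. -/
def indicatorMu (σ : ℝ) {E : Set ℝ} (hE : MeasurableSet E) : L2I σ :=
  indicatorConstLp 2 hE (measure_ne_top (mu σ) E) (1 : ℂ)

/-- The Riesz inequalities are tested on the `β` whose trigonometric series is the indicator of `E`.
Then `|E| = 2σ‖β‖²` and `∫_E D = ‖s‖²/(2π)`, whence the denominator `4πσ`. -/
theorem setLIntegral_D_bounds (hσ : 0 < σ) (B : L2R ℂ) {A C : ℝ} (hA : 0 < A) (hC : 0 < C)
    (h : ∀ β : lp (fun _ : ℤ => ℂ) 2,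
      Summable (fun j : ℤ => β j • shift (j * Real.pi / σ) B) ∧
      A * ‖β‖ ^ 2 ≤ ‖∑' j : ℤ, β j • shift (j * Real.pi / σ) B‖ ^ 2 ∧
      ‖∑' j : ℤ, β j • shift (j * Real.pi / σ) B‖ ^ 2 ≤ C * ‖β‖ ^ 2)
    {E : Set ℝ} (hE : MeasurableSet E) :
    ∫⁻ _ in E, ENNReal.ofReal (A / (4 * Real.pi * σ)) ∂(mu σ) ≤
        ∫⁻ y in E, ENNReal.ofReal (D B σ y) ∂(mu σ) ∧
      ∫⁻ y in E, ENNReal.ofReal (D B σ y) ∂(mu σ) ≤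
        ∫⁻ _ in E, ENNReal.ofReal (C / (4 * Real.pi * σ)) ∂(mu σ) := by
  obtain ⟨β, hβ⟩ := exists_trigSeries_eq hσ (indicatorMu σ hE)
  obtain ⟨hs, hl, hu⟩ := h β
  have hpi := Real.pi_pos
  have hmeas := lintegral_trigSeries_sq_mul hσ B β hs.hasSum
  have hae : ∀ᵐ y ∂(mu σ), ‖trigSeries σ β y‖ₑ ^ 2 = E.indicator (fun _ => (1 : ℝ≥0∞)) y := by
    rw [hβ]
    filter_upwards [indicatorConstLp_coeFn (p := 2) (hs := hE)
      (hμs := measure_ne_top (mu σ) E) (c := (1 : ℂ))] with y hy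
    rw [indicatorMu, hy]
    by_cases hyE : y ∈ E <;> simp [hyE]
  have h1 : ∫⁻ y in E, ENNReal.ofReal (D B σ y) ∂(mu σ) =
      ENNReal.ofReal (‖∑' j : ℤ, β j • shift (j * Real.pi / σ) B‖ ^ 2 / (2 * Real.pi)) := by
    rw [← hmeas, ← lintegral_indicator hE]
    refine lintegral_congr_ae ?_
    filter_upwards [hae] with y hy
    rw [hy]
    by_cases hyE : y ∈ E <;> simp [hyE]
  have h2 : (mu σ) E = ENNReal.ofReal (2 * σ * ‖β‖ ^ 2) := by
    rw [← norm_sq_trigSeries hσ, ← enorm_sq_eq_lintegral, lintegral_congr_ae hae,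
      lintegral_indicator_const hE, one_mul]
  rw [setLIntegral_const, setLIntegral_const, h1, h2, ← ENNReal.ofReal_mul (by positivity),
    ← ENNReal.ofReal_mul (by positivity)]
  constructor
  · refine ENNReal.ofReal_le_ofReal ?_
    rw [le_div_iff₀ (by positivity)]
    refine le_trans (le_of_eq ?_) hl
    field_simp
    ring
  · refine ENNReal.ofReal_le_ofReal ?_
    rw [div_le_iff₀ (by positivity)]
    refine hu.trans (le_of_eq ?_)
    field_simp
    ring

/-- Inequalities between integrals over all measurable `E` give inequalities a.e. on `[-σ, σ]`, and
periodicity of `D` carries them to the line. -/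
theorem exists_D_bounds (hσ : 0 < σ) (B : L2R ℂ)
    (hB : IsRieszSystem ℂ fun j : ℤ => shift (j * Real.pi / σ) B) :
    ∃ a b : ℝ, 0 < a ∧ 0 < b ∧ ∀ᵐ y : ℝ, a ≤ D B σ y ∧ D B σ y ≤ b := by
  obtain ⟨A, C, hA, hC, h⟩ := hB
  have hpi := Real.pi_pos
  have hm : AEMeasurable (fun y => ENNReal.ofReal (D B σ y)) (mu σ) :=
    (aemeasurable_mu_D σ B).ennreal_ofReal
  refine ⟨A / (4 * Real.pi * σ), C / (4 * Real.pi * σ), by positivity, by positivity,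
    ae_of_ae_mu_of_periodic hσ (fun m y => by rw [D_add_two_mul]) ?_⟩
  filter_upwards [ae_le_of_forall_setLIntegral_le_of_sigmaFinite₀ aemeasurable_const
      fun E hE _ => (setLIntegral_D_bounds hσ B hA hC h hE).1,
    ae_le_of_forall_setLIntegral_le_of_sigmaFinite₀ hm
      fun E hE _ => (setLIntegral_D_bounds hσ B hA hC h hE).2] with y h1 h2
  exact ⟨(ENNReal.ofReal_le_ofReal_iff (D_nonneg B y)).1 h1,
    (ENNReal.ofReal_le_ofReal_iff (by positivity)).1 h2⟩

end RieszBounds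

/-! ### Square sums of the samples `B(x - jπ/σ)` -/

section SquareSums

variable {σ : ℝ}

/-- `∑_j |B(x - jπ/σ)|²` as an extended nonnegative number. -/
def sampleSq (B : L2R ℂ) (σ x : ℝ) : ℝ≥0∞ := ∑' j : ℤ, ‖B (x - j * Real.pi / σ)‖ₑ ^ 2

/-- The step `π/σ` is twice `π/(2σ)`, so the periodization lemmas apply with `π/(2σ)` in the role of
`σ`. -/
theorem sampleSq_eq (hσ : 0 < σ) (B : L2R ℂ) (x : ℝ) :
    sampleSq B σ x = ∑' k : ℤ, ‖B (x + 2 * k * (Real.pi / (2 * σ)))‖ₑ ^ 2 := by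
  rw [sampleSq, ← (Equiv.neg ℤ).tsum_eq]
  refine tsum_congr fun k => ?_
  congr 4
  simp only [Equiv.neg_apply, Int.cast_neg]
  field_simp
  ring

theorem sampleSq_add (hσ : 0 < σ) (B : L2R ℂ) (m : ℤ) (x : ℝ) :
    sampleSq B σ (x + 2 * m * (Real.pi / (2 * σ))) = sampleSq B σ x := by
  rw [sampleSq_eq hσ, sampleSq_eq hσ]
  exact tsum_shift_two_mul _ (fun y => ‖B y‖ₑ ^ 2) m x

theorem aemeasurable_enorm_sq (B : L2R ℂ) : AEMeasurable fun x => ‖B x‖ₑ ^ 2 :=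
  (Lp.aestronglyMeasurable B).enorm.pow_const 2

theorem aestronglyMeasurable_comp_sub (B : L2R ℂ) (a : ℝ) :
    AEStronglyMeasurable (fun x : ℝ => B (x - a)) volume :=
  (Lp.aestronglyMeasurable B).comp_quasiMeasurePreserving
    (measurePreserving_sub_right volume a).quasiMeasurePreserving

theorem aemeasurable_sampleSq (B : L2R ℂ) (σ : ℝ) : AEMeasurable (sampleSq B σ) :=
  AEMeasurable.tsum fun _ => (aestronglyMeasurable_comp_sub B _).enorm.pow_const 2

theorem lintegral_sampleSq (hσ : 0 < σ) (B : L2R ℂ) :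
    ∫⁻ x, sampleSq B σ x ∂(mu (Real.pi / (2 * σ))) = ENNReal.ofReal (‖B‖ ^ 2) := by
  have hσ' : 0 < Real.pi / (2 * σ) := by positivity
  simp_rw [sampleSq_eq hσ]
  rw [← enorm_sq_eq_lintegral, lintegral_eq_lintegral_mu_tsum hσ' (aemeasurable_enorm_sq B)]

theorem ae_sampleSq_lt_top (hσ : 0 < σ) (B : L2R ℂ) : ∀ᵐ x : ℝ, sampleSq B σ x < ∞ := by
  have hσ' : 0 < Real.pi / (2 * σ) := by positivity
  refine ae_of_ae_mu_of_periodic hσ' (fun m x => by rw [sampleSq_add hσ]) ?_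
  refine ae_lt_top' (aemeasurable_sampleSq B σ).restrict ?_
  rw [lintegral_sampleSq hσ]
  exact ENNReal.ofReal_ne_top

theorem lintegral_Ioc_sampleSq_lt_top (hσ : 0 < σ) (B : L2R ℂ) (n : ℕ) :
    ∫⁻ x in Set.Ioc (-(n : ℝ)) n, sampleSq B σ x < ∞ := by
  have hσ' : 0 < Real.pi / (2 * σ) := by positivity
  set h := Real.pi / (2 * σ) with hh
  rw [← lintegral_indicator measurableSet_Ioc, lintegral_eq_tsum_lintegral_mu hσ']
  -- With `h = π/(2σ)`, the translates of `[-h, h]` by `2kh` with `|k| > M` miss `(-n, n]`, so only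
  -- finitely many periods contribute.
  obtain ⟨M, hM⟩ := exists_nat_gt ((n + h) / (2 * h))
  rw [div_lt_iff₀ (by positivity)] at hM
  rw [tsum_eq_sum (s := Finset.Icc (-(M : ℤ)) M)]
  · rw [ENNReal.sum_lt_top]
    intro k _
    refine lt_of_le_of_lt (lintegral_mono (g := sampleSq B σ) fun x => ?_) ?_
    · refine (Set.indicator_le_self' (fun _ _ => zero_le) _).trans ?_
      rw [sampleSq_add hσ]
    · rw [lintegral_sampleSq hσ]
      exact ENNReal.ofReal_lt_top
  · intro k hk
    rw [setLIntegral_congr_fun (g := fun _ => 0) measurableSet_Icc, lintegral_zero]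
    intro x hx
    refine Set.indicator_of_notMem (fun hx' => hk ?_) _
    obtain ⟨h1, h2⟩ := hx
    obtain ⟨h3, h4⟩ := hx'
    rw [Finset.mem_Icc]
    constructor
    · by_contra hlt
      have h5 : (k : ℝ) ≤ -(M : ℝ) - 1 := by
        have : k ≤ -(M : ℤ) - 1 := by omega
        exact_mod_cast this
      nlinarith
    · by_contra hlt
      have h5 : (M : ℝ) + 1 ≤ k := by
        have : (M : ℤ) + 1 ≤ k := by omega
        exact_mod_cast this
      nlinarith

theorem summable_sample_sq {B : L2R ℂ} {x : ℝ} (hx : sampleSq B σ x < ∞) :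
    Summable fun j : ℤ => ‖B (x - j * Real.pi / σ)‖ ^ 2 := by
  simpa using ENNReal.summable_toReal hx.ne

end SquareSums

/-! ### The kernel `Φ` and the truncated integrals -/

section ReproducingSeries

variable {σ : ℝ}

theorem star_coeFn (g : L2I σ) : ∀ᵐ y ∂(mu σ), (star g : L2I σ) y = (starRingEnd ℂ) (g y) :=
  Lp.coeFn_star g

theorem norm_star_L2I (g : L2I σ) : ‖(star g : L2I σ)‖ = ‖g‖ := by
  rw [Lp.norm_def, Lp.norm_def]
  refine congrArg ENNReal.toReal (eLpNorm_congr_norm_ae ?_)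
  filter_upwards [star_coeFn g] with y hy
  rw [hy, RCLike.norm_conj]

theorem continuous_star_L2I : Continuous fun g : L2I σ => (star g : L2I σ) := by
  have h : (fun g : L2I σ => (star g : L2I σ)) =
      (Complex.conjCLE : ℂ →L[ℝ] ℂ).compLpL 2 (mu σ) := by
    ext1 g
    refine Lp.ext ?_
    filter_upwards [star_coeFn g, (Complex.conjCLE : ℂ →L[ℝ] ℂ).coeFn_compLpL g] with y h1 h2
    rw [h1, h2]
    rfl
  rw [h]
  exact ContinuousLinearMap.continuous _

theorem inner_trig_star (j : ℤ) (g : L2I σ) :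
    inner ℂ (trig σ (-j)) (star g) = (starRingEnd ℂ) (inner ℂ (trig σ j) g) := by
  rw [inner_trig_eq_integral, inner_trig_eq_integral, ← integral_conj]
  refine integral_congr_ae ?_
  filter_upwards [star_coeFn g] with y hy
  rw [hy, map_mul, conj_trigFun]

theorem Phi_eq {B : L2R ℂ} (hσ : 0 < σ) {x : ℝ} (hx : sampleSq B σ x < ∞) :
    HasSum (fun j : ℤ => B (x - j * Real.pi / σ) • trig σ j) ((2 * σ : ℂ) • Phi B σ x) ∧
      ‖Phi B σ x‖ ^ 2 = 1 / (2 * σ) * (sampleSq B σ x).toReal := by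
  have hsum := summable_sample_sq hx
  have hneg : Summable fun j : ℤ => ‖B (x - ((-j : ℤ) : ℝ) * Real.pi / σ)‖ ^ 2 :=
    (Equiv.neg ℤ).summable_iff.2 hsum
  -- `Phi` uses `exp(+ijπy/σ)` and `trigSeries` uses `exp(-ijπy/σ)`, so the samples enter in
  -- reversed order.
  set c := toEllTwo (fun j : ℤ => B (x - ((-j : ℤ) : ℝ) * Real.pi / σ)) hneg with hc
  have h1 : HasSum (fun j : ℤ => B (x - j * Real.pi / σ) • trig σ j) (trigSeries σ c) := by
    rw [← (Equiv.neg ℤ).hasSum_iff]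
    exact hasSum_trigSeries' hσ c
  have h2 : Phi B σ x = (1 / (2 * σ) : ℂ) • trigSeries σ c := by
    rw [Phi]
    simp_rw [toC_complex]
    rw [h1.tsum_eq]
  have hs : (σ : ℂ) ≠ 0 := by exact_mod_cast hσ.ne'
  constructor
  · rw [h2, smul_smul, mul_one_div_cancel (by simp [hs]), one_smul]
    exact h1
  · have h3 : (sampleSq B σ x).toReal = ‖c‖ ^ 2 := by
      rw [hc, norm_sq_toEllTwo, sampleSq, ENNReal.tsum_toReal_eq fun k => by finiteness,
        ← (Equiv.neg ℤ).tsum_eq]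
      simp
    have h4 : ‖(1 / (2 * σ) : ℂ)‖ = 1 / (2 * σ) := by
      simp [abs_of_pos hσ]
    rw [h2, norm_smul, mul_pow, norm_sq_trigSeries hσ, h3, h4]
    field_simp

theorem inner_trig_Phi {B : L2R ℂ} (hσ : 0 < σ) {x : ℝ} (hx : sampleSq B σ x < ∞) (j : ℤ) :
    inner ℂ (trig σ j) (Phi B σ x) = B (x - j * Real.pi / σ) := by
  have hs : (2 * σ : ℂ) ≠ 0 := by
    have : (σ : ℂ) ≠ 0 := by exact_mod_cast hσ.ne'
    simp [this]
  have h := (Phi_eq hσ hx).1.mapL (innerSL ℂ (trig σ j))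
  have h' := hasSum_single (f := fun i : ℤ =>
    innerSL ℂ (trig σ j) (B (x - i * Real.pi / σ) • trig σ i)) j (fun i hi => by
      simp only [innerSL_apply_apply, inner_smul_right, inner_trig_trig hσ]
      rw [if_neg hi.symm, mul_zero])
  have h2 := h.unique h'
  simp only [innerSL_apply_apply, inner_smul_right, inner_trig_trig hσ, if_true] at h2
  rw [mul_comm] at h2
  push_cast at h2
  exact mul_right_cancel₀ hs h2

theorem aestronglyMeasurable_Phi (hσ : 0 < σ) (B : L2R ℂ) :
    AEStronglyMeasurable (Phi B σ) volume := by
  have h : AEStronglyMeasurable (fun x => (2 * σ : ℂ) • Phi B σ x) volume := by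
    refine aestronglyMeasurable_of_tendsto_ae (atTop : Filter (Finset ℤ))
      (f := fun K x => ∑ j ∈ K, B (x - j * Real.pi / σ) • trig σ j) (fun K => ?_) ?_
    · exact Finset.aestronglyMeasurable_fun_sum K fun j _ =>
        (aestronglyMeasurable_comp_sub B _).smul_const _
    · filter_upwards [ae_sampleSq_lt_top hσ B] with x hx
      simpa [HasSum] using (Phi_eq hσ hx).1
  have hs : (2 * σ : ℂ) ≠ 0 := by
    have : (σ : ℂ) ≠ 0 := by exact_mod_cast hσ.ne'
    simp [this]
  refine (h.const_smul (2 * σ : ℂ)⁻¹).congr (Eventually.of_forall fun x => ?_)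
  simp only [Pi.smul_apply]
  rw [inv_smul_smul₀ hs]

/-- The norm is at most `|f|² + ‖Φ‖²`, and `‖Φ‖²` is a multiple of the locally integrable
`sampleSq`. -/
theorem integrableOn_smul_star_Phi (hσ : 0 < σ) (B f : L2R ℂ) (n : ℕ) :
    IntegrableOn (fun t => f t • (star (Phi B σ t) : L2I σ)) (Set.Ioc (-(n : ℝ)) n) := by
  have hG : IntegrableOn (fun t => (sampleSq B σ t).toReal) (Set.Ioc (-(n : ℝ)) n) :=
    integrable_toReal_of_lintegral_ne_top (aemeasurable_sampleSq B σ).restrict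
      (lintegral_Ioc_sampleSq_lt_top hσ B n).ne
  have hf : Integrable (fun t => ‖f t‖ ^ 2) := (memLp_two_iff_integrable_sq_norm
    (Lp.aestronglyMeasurable f)).1 (Lp.memLp f)
  refine Integrable.mono' ((hf.integrableOn (s := Set.Ioc (-(n : ℝ)) n)).add
    (hG.const_mul (1 / (2 * σ)))) ?_ ?_
  · exact ((Lp.aestronglyMeasurable f).smul (continuous_star_L2I.comp_aestronglyMeasurable
      (aestronglyMeasurable_Phi hσ B))).restrict
  · refine ae_restrict_of_ae ?_
    filter_upwards [ae_sampleSq_lt_top hσ B] with t ht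
    simp only [Pi.add_apply]
    rw [norm_smul, norm_star_L2I, ← (Phi_eq hσ ht).2]
    nlinarith [sq_nonneg (‖f t‖ - ‖Phi B σ t‖), sq_nonneg ‖f t‖, sq_nonneg ‖Phi B σ t‖]

theorem truncInt_eq (B f : L2R ℂ) (n : ℕ) :
    truncInt B σ f n = ∫ t in Set.Ioc (-(n : ℝ)) n, f t • (star (Phi B σ t) : L2I σ) := by
  rw [truncInt, intervalIntegral.integral_of_le (by linarith [n.cast_nonneg (α := ℝ)])]
  simp_rw [toC_complex]

/-- The truncation of `f` to `(-n, n]`. -/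
def truncation (f : L2R ℂ) (n : ℕ) : L2R ℂ :=
  ((Lp.memLp f).indicator (measurableSet_Ioc (a := -(n : ℝ)) (b := n))).toLp _

theorem truncation_coeFn (f : L2R ℂ) (n : ℕ) :
    ∀ᵐ t : ℝ, truncation f n t = (Set.Ioc (-(n : ℝ)) n).indicator f t :=
  ((Lp.memLp f).indicator (measurableSet_Ioc (a := -(n : ℝ)) (b := n))).coeFn_toLp

/-- The inner product passes under the vector-valued integral and picks out one coefficient of `conj
Φ`, namely `conj (B(t - jπ/σ))`. -/
theorem inner_trig_truncInt (hσ : 0 < σ) (B f : L2R ℂ) (n : ℕ) (j : ℤ) :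
    inner ℂ (trig σ (-j)) (truncInt B σ f n) =
      inner ℂ (shift (j * Real.pi / σ) B) (truncation f n) := by
  rw [truncInt_eq, ← integral_inner (integrableOn_smul_star_Phi hσ B f n), L2.inner_def,
    ← integral_indicator measurableSet_Ioc]
  refine integral_congr_ae ?_
  filter_upwards [truncation_coeFn f n, shift_coeFn (j * Real.pi / σ) B,
    ae_sampleSq_lt_top hσ B] with t h1 h2 h3
  rw [h1, h2]
  by_cases ht : t ∈ Set.Ioc (-(n : ℝ)) n
  · rw [Set.indicator_of_mem ht, Set.indicator_of_mem ht, inner_smul_right, inner_trig_star,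
      inner_trig_Phi hσ h3, RCLike.inner_apply]
  · rw [Set.indicator_of_notMem ht, Set.indicator_of_notMem ht, inner_zero_right]

theorem tendsto_truncation (f : L2R ℂ) : Tendsto (truncation f) atTop (𝓝 f) := by
  have hf : ∫⁻ t, ‖f t‖ₑ ^ 2 ≠ ∞ := by
    rw [enorm_sq_eq_lintegral]
    exact ENNReal.ofReal_ne_top
  have h : Tendsto (fun n => ∫⁻ t, ‖(truncation f n - f) t‖ₑ ^ 2) atTop (𝓝 0) := by
    have h0 : ∀ n, ∫⁻ t, ‖(truncation f n - f) t‖ₑ ^ 2 =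
        ∫⁻ t, (Set.Ioc (-(n : ℝ)) n)ᶜ.indicator (fun t => ‖f t‖ₑ ^ 2) t := by
      intro n
      refine lintegral_congr_ae ?_
      filter_upwards [truncation_coeFn f n, Lp.coeFn_sub (truncation f n) f] with t h1 h2
      rw [h2, Pi.sub_apply, h1]
      by_cases ht : t ∈ Set.Ioc (-(n : ℝ)) n <;> simp [ht]
    simp_rw [h0]
    rw [← lintegral_zero (μ := (volume : Measure ℝ))]
    refine tendsto_lintegral_of_dominated_convergence' (fun t => ‖f t‖ₑ ^ 2)
      (fun n => (aemeasurable_enorm_sq f).indicator measurableSet_Ioc.compl)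
      (fun n => Eventually.of_forall fun t => Set.indicator_le_self' (fun _ _ => zero_le) t) hf
      (Eventually.of_forall fun t => ?_)
    refine tendsto_const_nhds.congr' ?_
    obtain ⟨N, hN⟩ := exists_nat_gt |t|
    filter_upwards [eventually_ge_atTop N] with n hn
    have hn' : (N : ℝ) ≤ n := by exact_mod_cast hn
    have := abs_lt.1 (hN.trans_le hn')
    rw [Set.indicator_of_notMem]
    rw [Set.mem_compl_iff, not_not]
    exact ⟨this.1, this.2.le⟩
  simp_rw [enorm_sq_eq_lintegral] at h
  rw [tendsto_iff_norm_sub_tendsto_zero]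
  have h2 := (ENNReal.tendsto_toReal ENNReal.zero_ne_top).comp h
  simp only [Function.comp_def, ENNReal.toReal_zero] at h2
  have h3 := h2.sqrt
  simp only [Real.sqrt_zero] at h3
  refine h3.congr fun n => ?_
  rw [ENNReal.toReal_ofReal (by positivity), Real.sqrt_sq (norm_nonneg _)]

end ReproducingSeries

/-! ### The cross series and the formula for `ζ` -/

section CrossSeries

variable {σ : ℝ}

theorem integral_mu_tsum (hσ : 0 < σ) {h : ℝ → ℂ} (hh : Integrable h) :
    ∫ y, ∑' k : ℤ, h (y + 2 * k * σ) ∂(mu σ) = ∫ y, h y := by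
  rw [integral_eq_tsum_integral_mu hσ hh]
  refine integral_tsum (fun k => hh.aestronglyMeasurable.comp_quasiMeasurePreserving
    (quasiMeasurePreserving_add_mu σ _)) ?_
  rw [← lintegral_eq_tsum_lintegral_mu hσ fun y => ‖h y‖ₑ]
  exact hh.2.ne

theorem ae_summable_crossTerm (hσ : 0 < σ) (B f : L2R ℂ) :
    ∀ᵐ y : ℝ, Summable fun k : ℤ => crossTerm B σ f k y := by
  filter_upwards [ae_summable_hat_sq hσ B, ae_summable_hat_sq hσ f] with y h1 h2
  exact summable_conj_mul h1 h2

theorem ae_mu_of_ae {p : ℝ → Prop} (h : ∀ᵐ y : ℝ, p y) : ∀ᵐ y ∂(mu σ), p y :=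
  ae_restrict_of_ae h

theorem aestronglyMeasurable_crossTerm (B f : L2R ℂ) (k : ℤ) :
    AEStronglyMeasurable (crossTerm B σ f k) (mu σ) :=
  (Complex.continuous_conj.comp_aestronglyMeasurable (aestronglyMeasurable_hat_add σ B k)).mul
    (aestronglyMeasurable_hat_add σ f k)

theorem aestronglyMeasurable_tsum_crossTerm (hσ : 0 < σ) (B f : L2R ℂ) :
    AEStronglyMeasurable (fun y => ∑' k : ℤ, crossTerm B σ f k y) (mu σ) := by
  refine aestronglyMeasurable_of_tendsto_ae (atTop : Filter (Finset ℤ))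
    (f := fun K y => ∑ k ∈ K, crossTerm B σ f k y) (fun K => ?_) ?_
  · exact Finset.aestronglyMeasurable_fun_sum K fun k _ => aestronglyMeasurable_crossTerm B f k
  · filter_upwards [ae_mu_of_ae (ae_summable_crossTerm hσ B f)] with y hy
    simpa [HasSum] using hy.hasSum

theorem ae_norm_tsum_crossTerm_sq_le (hσ : 0 < σ) (B f : L2R ℂ) :
    ∀ᵐ y : ℝ, ‖∑' k : ℤ, crossTerm B σ f k y‖ ^ 2 ≤ D B σ y * D f σ y := by
  filter_upwards [ae_summable_hat_sq hσ B, ae_summable_hat_sq hσ f] with y h1 h2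
  exact norm_tsum_conj_mul_sq_le h1 h2

variable {B : L2R ℂ} {b : ℝ}

theorem lintegral_tsum_crossTerm_sq_le (hσ : 0 < σ) (hb : ∀ᵐ y : ℝ, D B σ y ≤ b) (f : L2R ℂ) :
    ∫⁻ y, ‖∑' k : ℤ, crossTerm B σ f k y‖ₑ ^ 2 ∂(mu σ) ≤
      ENNReal.ofReal b * ENNReal.ofReal (‖f‖ ^ 2 / (2 * Real.pi)) := by
  rw [← lintegral_mu_D hσ, ← lintegral_const_mul' _ _ ENNReal.ofReal_ne_top]
  refine lintegral_mono_ae ?_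
  filter_upwards [ae_mu_of_ae hb, ae_mu_of_ae (ae_norm_tsum_crossTerm_sq_le hσ B f)] with y h1 h2
  rw [← ofReal_norm, ← ENNReal.ofReal_pow (norm_nonneg _),
    ← ENNReal.ofReal_mul ((D_nonneg B y).trans h1)]
  exact ENNReal.ofReal_le_ofReal (h2.trans (mul_le_mul_of_nonneg_right h1 (D_nonneg f y)))

theorem memLp_tsum_crossTerm (hσ : 0 < σ) (hb : ∀ᵐ y : ℝ, D B σ y ≤ b) (f : L2R ℂ) :
    MemLp (fun y => ∑' k : ℤ, crossTerm B σ f k y) 2 (mu σ) :=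
  memLp_two_of_lintegral_lt_top (aestronglyMeasurable_tsum_crossTerm hσ B f)
    ((lintegral_tsum_crossTerm_sq_le hσ hb f).trans_lt (by finiteness))

/-- `∑_k conj (B̂(· + 2kσ)) f̂(· + 2kσ)` as an element of `L₂[-σ, σ]`. -/
def crossLp (hσ : 0 < σ) (hb : ∀ᵐ y : ℝ, D B σ y ≤ b) (f : L2R ℂ) : L2I σ :=
  (memLp_tsum_crossTerm hσ hb f).toLp _

theorem crossLp_coeFn (hσ : 0 < σ) (hb : ∀ᵐ y : ℝ, D B σ y ≤ b) (f : L2R ℂ) :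
    ∀ᵐ y ∂(mu σ), crossLp hσ hb f y = ∑' k : ℤ, crossTerm B σ f k y :=
  (memLp_tsum_crossTerm hσ hb f).coeFn_toLp

theorem norm_crossLp_sq_le (hσ : 0 < σ) (hb : ∀ᵐ y : ℝ, D B σ y ≤ b) (f : L2R ℂ) :
    ‖crossLp hσ hb f‖ ^ 2 ≤ b * (‖f‖ ^ 2 / (2 * Real.pi)) := by
  have hb0 : 0 ≤ b := by
    obtain ⟨y, hy⟩ := hb.exists
    exact (D_nonneg B y).trans hy
  have hpi := Real.pi_pos
  rw [← ENNReal.ofReal_le_ofReal_iff (by positivity), ← enorm_sq_eq_lintegral,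
    ENNReal.ofReal_mul hb0]
  refine le_trans (le_of_eq (lintegral_congr_ae ?_)) (lintegral_tsum_crossTerm_sq_le hσ hb f)
  filter_upwards [crossLp_coeFn hσ hb f] with y hy
  rw [hy]

/-- The periodic exponential moves inside the sum over `k` and turns `conj B̂` into the conjugate
transform of the shifted `B`. The periodized integral unfolds to the line, where Plancherel applies.
-/
theorem inner_trig_crossLp (hσ : 0 < σ) (hb : ∀ᵐ y : ℝ, D B σ y ≤ b) (f : L2R ℂ) (j : ℤ) :
    inner ℂ (trig σ (-j)) (crossLp hσ hb f) =
      (1 / (2 * Real.pi) : ℂ) * inner ℂ (shift (j * Real.pi / σ) B) f := by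
  rw [← integral_conj_hat_mul_hat, inner_trig_eq_integral, neg_neg]
  have hint : Integrable (fun y => (starRingEnd ℂ) (hat (shift (j * Real.pi / σ) B) y) *
      hat f y) := (memLp_hat (shift (j * Real.pi / σ) B)).star.integrable_mul (memLp_hat f)
  rw [← integral_mu_tsum hσ hint]
  refine integral_congr_ae ?_
  filter_upwards [crossLp_coeFn hσ hb f,
    ae_mu_forall_add (σ := σ) (hat_shift (j * Real.pi / σ) B)] with y h1 h2
  rw [h1, ← tsum_mul_left]
  refine tsum_congr fun k => ?_
  rw [h2, exp_neg_eq_trigFun, map_mul, conj_trigFun, neg_neg, trigFun_add_two_mul hσ, crossTerm]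
  ring

theorem crossLp_sub (hσ : 0 < σ) (hb : ∀ᵐ y : ℝ, D B σ y ≤ b) (f g : L2R ℂ) :
    crossLp hσ hb (f - g) = crossLp hσ hb f - crossLp hσ hb g := by
  refine ext_inner_trig hσ fun j => ?_
  rw [inner_sub_right, inner_trig_crossLp, inner_trig_crossLp, inner_trig_crossLp,
    inner_sub_right, mul_sub]

theorem continuous_crossLp (hσ : 0 < σ) (hb : ∀ᵐ y : ℝ, D B σ y ≤ b) :
    Continuous (crossLp hσ hb) := by
  refine continuous_iff_continuousAt.2 fun g => ?_
  rw [ContinuousAt, tendsto_iff_norm_sub_tendsto_zero]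
  have h : Tendsto (fun f : L2R ℂ => Real.sqrt (b * (‖f - g‖ ^ 2 / (2 * Real.pi)))) (𝓝 g)
      (𝓝 0) := by
    have hc : Continuous fun f : L2R ℂ => Real.sqrt (b * (‖f - g‖ ^ 2 / (2 * Real.pi))) := by
      fun_prop
    simpa using hc.tendsto g
  refine squeeze_zero (fun _ => norm_nonneg _) (fun f => ?_) h
  rw [← crossLp_sub]
  exact Real.le_sqrt_of_sq_le (norm_crossLp_sq_le hσ hb _)

/-- Both sides have the same Fourier coefficients. -/
theorem truncInt_eq_crossLp (hσ : 0 < σ) (hb : ∀ᵐ y : ℝ, D B σ y ≤ b) (f : L2R ℂ) (n : ℕ) :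
    truncInt B σ f n = (2 * Real.pi : ℂ) • crossLp hσ hb (truncation f n) := by
  have hpi : (Real.pi : ℂ) ≠ 0 := by exact_mod_cast Real.pi_ne_zero
  refine ext_inner_trig hσ fun j => ?_
  rw [inner_trig_truncInt hσ, inner_smul_right, inner_trig_crossLp]
  field_simp

theorem tendsto_truncInt (hσ : 0 < σ) (hb : ∀ᵐ y : ℝ, D B σ y ≤ b) (f : L2R ℂ) :
    Tendsto (truncInt B σ f) atTop (𝓝 ((2 * Real.pi : ℂ) • crossLp hσ hb f)) := by
  have h := (((continuous_crossLp hσ hb).tendsto f).comp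
    (tendsto_truncation f)).const_smul (2 * Real.pi : ℂ)
  exact h.congr fun n => (truncInt_eq_crossLp hσ hb f n).symm

theorem fullInt_eq (hσ : 0 < σ) (hb : ∀ᵐ y : ℝ, D B σ y ≤ b) (f : L2R ℂ) :
    fullInt B σ f = (2 * Real.pi : ℂ) • crossLp hσ hb f :=
  (tendsto_truncInt hσ hb f).limUnder_eq

theorem zeta_eq (hσ : 0 < σ) (hb : ∀ᵐ y : ℝ, D B σ y ≤ b) (f : L2R ℂ) :
    ∀ᵐ y ∂(mu σ), zeta B σ f y = (1 / D B σ y : ℂ) * ∑' k : ℤ, crossTerm B σ f k y := by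
  have hpi : (Real.pi : ℂ) ≠ 0 := by exact_mod_cast Real.pi_ne_zero
  filter_upwards [crossLp_coeFn hσ hb f,
    Lp.coeFn_smul (2 * Real.pi : ℂ) (crossLp hσ hb f)] with y h1 h2
  rw [zeta, fullInt_eq hσ hb, h2, Pi.smul_apply, h1, smul_eq_mul]
  have : (1 / (2 * Real.pi * D B σ y) : ℂ) = (1 / (2 * Real.pi)) * (1 / D B σ y) := by
    rw [div_mul_div_comm, one_mul]
  rw [this]
  field_simp

variable {a : ℝ}

theorem memLp_zeta (hσ : 0 < σ) (ha0 : 0 < a) (ha : ∀ᵐ y : ℝ, a ≤ D B σ y)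
    (hb : ∀ᵐ y : ℝ, D B σ y ≤ b) (f : L2R ℂ) : MemLp (zeta B σ f) 2 (mu σ) := by
  refine MemLp.ae_eq (f := fun y => (1 / D B σ y : ℂ) * ∑' k : ℤ, crossTerm B σ f k y) ?_ ?_
  · filter_upwards [zeta_eq hσ hb f] with y hy using hy.symm
  refine MemLp.of_le_mul (c := 1 / a) (memLp_tsum_crossTerm hσ hb f) ?_ ?_
  · refine AEStronglyMeasurable.mul ?_ (aestronglyMeasurable_tsum_crossTerm hσ B f)
    have h := ((aemeasurable_mu_D σ B).complex_ofReal).const_div 1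
    exact h.aestronglyMeasurable
  · filter_upwards [ae_mu_of_ae ha] with y hy
    rw [norm_mul]
    refine mul_le_mul_of_nonneg_right ?_ (norm_nonneg _)
    rw [norm_div, norm_one, Complex.norm_real, Real.norm_of_nonneg (D_nonneg B y)]
    exact one_div_le_one_div_of_le ha0 hy

/-- Cauchy–Schwarz for the fibre of `B` against the tail of the fibre of `f`: the bound is `D⁻² · D`
times the squared tail, and `1/D ≤ 1/a`. -/
theorem ae_enorm_remainder_sq_le (hσ : 0 < σ) (ha0 : 0 < a) (ha : ∀ᵐ y : ℝ, a ≤ D B σ y)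
    (f : L2R ℂ) (K : Finset ℤ) :
    ∀ᵐ y : ℝ, ‖(1 / D B σ y : ℂ) * ∑' k : ℤ, crossTerm B σ f k y -
        (1 / D B σ y : ℂ) * ∑ k ∈ K, crossTerm B σ f k y‖ₑ ^ 2 ≤
      ENNReal.ofReal (1 / a) * ∑' k : {k // k ∉ K}, ‖hat f (y + 2 * (k : ℤ) * σ)‖ₑ ^ 2 := by
  filter_upwards [ha, ae_summable_hat_sq hσ B, ae_summable_hat_sq hσ f,
    ae_summable_crossTerm hσ B f] with y h1 h2 h3 h4
  classical
  -- The fibre of `f` with its entries in `K` set to zero.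
  set v : ℤ → ℂ := fun k => if k ∈ K then 0 else hat f (y + 2 * k * σ) with hv
  have hvs : ∀ k, ‖v k‖ ^ 2 ≤ ‖hat f (y + 2 * k * σ)‖ ^ 2 := by
    intro k
    by_cases hk : k ∈ K <;> simp [hv, hk]
  have hvsum : Summable fun k => ‖v k‖ ^ 2 :=
    Summable.of_nonneg_of_le (fun _ => by positivity) hvs h3
  have e1 : ∑' k : ℤ, crossTerm B σ f k y - ∑ k ∈ K, crossTerm B σ f k y =
      ∑' k : ℤ, (starRingEnd ℂ) (hat B (y + 2 * k * σ)) * v k := by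
    have e2 : ∑ k ∈ K, crossTerm B σ f k y =
        ∑' k : ℤ, if k ∈ K then crossTerm B σ f k y else 0 := by
      rw [tsum_eq_sum (s := K) (fun k hk => by simp [hk])]
      exact Finset.sum_congr rfl fun k hk => by simp [hk]
    rw [e2, ← h4.tsum_sub (summable_of_ne_finset_zero (s := K) fun k hk => by simp [hk])]
    refine tsum_congr fun k => ?_
    by_cases hk : k ∈ K <;> simp [hv, hk, crossTerm]
  have hD : 0 < D B σ y := ha0.trans_le h1
  have e3 : ∑' k : {k // k ∉ K}, ‖hat f (y + 2 * (k : ℤ) * σ)‖ₑ ^ 2 =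
      ENNReal.ofReal (∑' k, ‖v k‖ ^ 2) := by
    rw [ENNReal.ofReal_tsum_of_nonneg (fun _ => by positivity) hvsum]
    have := tsum_subtype {k : ℤ | k ∉ K} fun k => ‖hat f (y + 2 * (k : ℤ) * σ)‖ₑ ^ 2
    refine Eq.trans this (tsum_congr fun k => ?_)
    by_cases hk : k ∈ K <;> simp [hv, hk, ENNReal.ofReal_pow]
  have e4 := norm_tsum_conj_mul_sq_le h2 hvsum
  rw [← mul_sub, e1, e3, ← ENNReal.ofReal_mul (by positivity), ← ofReal_norm,
    ← ENNReal.ofReal_pow (norm_nonneg _)]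
  refine ENNReal.ofReal_le_ofReal ?_
  have h5 : ‖(1 / D B σ y : ℂ)‖ = 1 / D B σ y := by
    rw [norm_div, norm_one, Complex.norm_real, Real.norm_of_nonneg hD.le]
  have hq : 0 ≤ ∑' k, ‖v k‖ ^ 2 := tsum_nonneg fun _ => by positivity
  rw [norm_mul, mul_pow, h5]
  calc (1 / D B σ y) ^ 2 * ‖∑' k : ℤ, (starRingEnd ℂ) (hat B (y + 2 * k * σ)) * v k‖ ^ 2
      ≤ (1 / D B σ y) ^ 2 * (D B σ y * ∑' k, ‖v k‖ ^ 2) :=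
        mul_le_mul_of_nonneg_left e4 (by positivity)
    _ = 1 / D B σ y * ∑' k, ‖v k‖ ^ 2 := by field_simp
    _ ≤ 1 / a * ∑' k, ‖v k‖ ^ 2 :=
        mul_le_mul_of_nonneg_right (one_div_le_one_div_of_le ha0 h1) hq

/-- The squared norm is at most `1/a` times a tail of `∑_k ∫ |f̂(y + 2kσ)|² dy`, which converges to
`∫_ℝ |f̂|²`. -/
theorem tendsto_eLpNorm_zeta_sub (hσ : 0 < σ) (ha0 : 0 < a) (ha : ∀ᵐ y : ℝ, a ≤ D B σ y)
    (hb : ∀ᵐ y : ℝ, D B σ y ≤ b) (f : L2R ℂ) :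
    Tendsto (fun K : Finset ℤ => eLpNorm (fun y => zeta B σ f y -
      (1 / D B σ y : ℂ) * ∑ k ∈ K, crossTerm B σ f k y) 2 (mu σ)) atTop (𝓝 0) := by
  have hfin : ∑' k : ℤ, ∫⁻ y, ‖hat f (y + 2 * k * σ)‖ₑ ^ 2 ∂(mu σ) ≠ ∞ := by
    rw [← lintegral_eq_tsum_lintegral_mu hσ fun y => ‖hat f y‖ₑ ^ 2, lintegral_hat]
    exact ENNReal.ofReal_ne_top
  have htail := ENNReal.Tendsto.const_mul (a := ENNReal.ofReal (1 / a))
    (ENNReal.tendsto_tsum_compl_atTop_zero hfin) (Or.inr ENNReal.ofReal_ne_top)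
  rw [mul_zero] at htail
  have hsq : Tendsto (fun K : Finset ℤ => eLpNorm (fun y => zeta B σ f y -
      (1 / D B σ y : ℂ) * ∑ k ∈ K, crossTerm B σ f k y) 2 (mu σ) ^ (2 : ℝ)) atTop (𝓝 0) := by
    refine tendsto_of_tendsto_of_tendsto_of_le_of_le tendsto_const_nhds htail
      (fun _ => zero_le) fun K => ?_
    have h' := eLpNorm_nnreal_pow_eq_lintegral (μ := mu σ) (f := fun y => zeta B σ f y -
      (1 / D B σ y : ℂ) * ∑ k ∈ K, crossTerm B σ f k y) (p := 2) two_ne_zero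
    simp only [ENNReal.coe_ofNat, NNReal.coe_ofNat] at h'
    simp only
    rw [h', ← lintegral_tsum fun k : {k // k ∉ K} => aemeasurable_mu_enorm_hat_sq σ f k,
      ← lintegral_const_mul' _ _ ENNReal.ofReal_ne_top]
    refine lintegral_mono_ae ?_
    filter_upwards [zeta_eq hσ hb f,
      ae_mu_of_ae (ae_enorm_remainder_sq_le hσ ha0 ha f K)] with y h1 h2
    rw [h1]
    exact_mod_cast h2
  have h := ((ENNReal.continuous_rpow_const (y := (1 / 2 : ℝ))).tendsto 0).comp hsq
  rw [ENNReal.zero_rpow_of_pos (by norm_num)] at h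
  refine h.congr fun K => ?_
  rw [Function.comp_apply, ← ENNReal.rpow_mul, show (2 : ℝ) * (1 / 2) = 1 by norm_num,
    ENNReal.rpow_one]

end CrossSeries

/-! ### Best approximation in the complex case -/

section BestApproximation

variable {σ ρ : ℝ} {B : L2R ℂ} {a b : ℝ}

/-- The density `|∑_k conj (B̂(y + 2kσ)) f̂(y + 2kσ)|² / D(y)`. -/
def projDensity (B : L2R ℂ) (σ : ℝ) (f : L2R ℂ) (y : ℝ) : ℝ :=
  1 / D B σ y * ‖∑' k : ℤ, crossTerm B σ f k y‖ ^ 2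

theorem projDensity_nonneg (f : L2R ℂ) (y : ℝ) : 0 ≤ projDensity B σ f y :=
  mul_nonneg (one_div_nonneg.2 (D_nonneg B y)) (by positivity)

theorem integrable_projDensity (hσ : 0 < σ) (ha0 : 0 < a) (ha : ∀ᵐ y : ℝ, a ≤ D B σ y)
    (f : L2R ℂ) : Integrable (projDensity B σ f) (mu σ) := by
  refine (integrable_mu_D hσ f).mono' ?_ ?_
  · exact ((aemeasurable_mu_D σ B).const_div 1).aestronglyMeasurable.mul
      ((aestronglyMeasurable_tsum_crossTerm hσ B f).norm.pow 2)
  · filter_upwards [ae_mu_of_ae ha, ae_mu_of_ae (ae_norm_tsum_crossTerm_sq_le hσ B f)]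
      with y h1 h2
    have hD : 0 < D B σ y := ha0.trans_le h1
    rw [Real.norm_of_nonneg (projDensity_nonneg f y), projDensity, one_div_mul_eq_div,
      div_le_iff₀ hD, mul_comm]
    exact h2

theorem ae_D_sub (hσ : 0 < σ) (ha0 : 0 < a) (ha : ∀ᵐ y : ℝ, a ≤ D B σ y)
    (hb : ∀ᵐ y : ℝ, D B σ y ≤ b) (f : L2R ℂ) (β : lp (fun _ : ℤ => ℂ) 2) {s : L2R ℂ}
    (hs : HasSum (fun j : ℤ => β j • shift (j * Real.pi / σ) B) s) :
    ∀ᵐ y ∂(mu σ), D (f - s) σ y = D f σ y - projDensity B σ f y +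
      D B σ y * ‖trigSeries σ β y - zeta B σ f y‖ ^ 2 := by
  filter_upwards [hat_eq_trigSeries_mul hσ B β hs, ae_mu_forall_add (σ := σ) (hat_sub f s),
    ae_mu_of_ae ha, ae_mu_of_ae (ae_summable_hat_sq hσ B), ae_mu_of_ae (ae_summable_hat_sq hσ f),
    zeta_eq hσ hb f] with y h1 h2 h3 h4 h5 h6
  have h := tsum_norm_sub_mul_sq h4 h5 (trigSeries σ β y) (ha0.trans_le h3)
  rw [h6]
  refine Eq.trans ?_ h.tsum_eq
  refine tsum_congr fun k => ?_
  rw [h2, h1]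

theorem ae_residual (hσ : 0 < σ) (ha0 : 0 < a) (ha : ∀ᵐ y : ℝ, a ≤ D B σ y)
    (hb : ∀ᵐ y : ℝ, D B σ y ≤ b) (f : L2R ℂ) :
    ∀ᵐ y ∂(mu σ), D B σ y * ‖zeta B σ f y‖ ^ 2 = projDensity B σ f y := by
  filter_upwards [ae_mu_of_ae ha, zeta_eq hσ hb f] with y h1 h2
  have hD : 0 < D B σ y := ha0.trans_le h1
  rw [h2, projDensity, norm_mul, norm_div, norm_one, Complex.norm_real,
    Real.norm_of_nonneg hD.le]
  field_simp

/-- The value of the squared best approximation. -/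
def bestValue (B : L2R ℂ) (σ ρ : ℝ) (f : L2R ℂ) : ℝ :=
  2 * Real.pi * ((∫ y : ℝ, ‖hat f y‖ ^ 2) - ∫ y in (-ρ)..ρ, projDensity B σ f y)

theorem integral_indicator_projDensity (hρ : 0 < ρ) (hρσ : ρ ≤ σ) (f : L2R ℂ) :
    ∫ y, (Set.Icc (-ρ) ρ).indicator (projDensity B σ f) y ∂(mu σ) =
      ∫ y in (-ρ)..ρ, projDensity B σ f y := by
  rw [integral_indicator measurableSet_Icc, Measure.restrict_restrict measurableSet_Icc,
    Set.inter_eq_left.2 (Set.Icc_subset_Icc (by linarith) hρσ),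
    intervalIntegral.integral_of_le (by linarith), integral_Icc_eq_integral_Ioc]

/-- Integrates the fibrewise square completion. The density is split at `±ρ`: its inner part goes
into `bestValue`, its outer part into the excess integral that the next two results bound below and
annihilate. -/
theorem norm_sub_sq_eq (hσ : 0 < σ) (ha0 : 0 < a) (ha : ∀ᵐ y : ℝ, a ≤ D B σ y)
    (hb : ∀ᵐ y : ℝ, D B σ y ≤ b) (hρ : 0 < ρ) (hρσ : ρ ≤ σ) (f : L2R ℂ)
    (β : lp (fun _ : ℤ => ℂ) 2) {s : L2R ℂ}
    (hs : HasSum (fun j : ℤ => β j • shift (j * Real.pi / σ) B) s) :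
    Integrable (fun y => D B σ y * ‖trigSeries σ β y - zeta B σ f y‖ ^ 2) (mu σ) ∧
    ‖f - s‖ ^ 2 = bestValue B σ ρ f + 2 * Real.pi * ∫ y,
      (D B σ y * ‖trigSeries σ β y - zeta B σ f y‖ ^ 2 -
        (Set.Icc (-ρ) ρ)ᶜ.indicator (projDensity B σ f) y) ∂(mu σ) := by
  have hq := integrable_projDensity hσ ha0 ha f
  have h0 := integrable_mu_D hσ f
  have h1 := integrable_mu_D hσ (f - s)
  have hD := ae_D_sub hσ ha0 ha hb f β hs
  have hr : Integrable (fun y => D B σ y * ‖trigSeries σ β y - zeta B σ f y‖ ^ 2) (mu σ) := by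
    refine (h1.sub (h0.sub hq)).congr ?_
    filter_upwards [hD] with y hy
    simp only [Pi.sub_apply]
    rw [hy]
    ring
  refine ⟨hr, ?_⟩
  have hqi := hq.indicator (measurableSet_Icc (a := -ρ) (b := ρ))
  have hqc := hq.indicator (measurableSet_Icc (a := -ρ) (b := ρ)).compl
  have e1 : ∫ y, D (f - s) σ y ∂(mu σ) = ∫ y, D f σ y ∂(mu σ) -
      ∫ y, (Set.Icc (-ρ) ρ).indicator (projDensity B σ f) y ∂(mu σ) +
      ∫ y, (D B σ y * ‖trigSeries σ β y - zeta B σ f y‖ ^ 2 -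
        (Set.Icc (-ρ) ρ)ᶜ.indicator (projDensity B σ f) y) ∂(mu σ) := by
    rw [← integral_sub h0 hqi]
    refine Eq.trans (integral_congr_ae ?_) (integral_add (h0.sub hqi) (hr.sub hqc))
    filter_upwards [hD] with y hy
    rw [hy]
    by_cases hyI : y ∈ Set.Icc (-ρ) ρ
    · rw [Set.indicator_of_mem hyI, Set.indicator_of_notMem (by simpa using hyI)]
      ring
    · rw [Set.indicator_of_notMem hyI, Set.indicator_of_mem (by simpa using hyI)]
      ring
  rw [integral_mu_D hσ, integral_mu_D hσ, ← integral_hat f,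
    integral_indicator_projDensity hρ hρσ] at e1
  have hpi := Real.pi_pos
  rw [div_eq_iff (by positivity)] at e1
  rw [bestValue, e1]
  ring

theorem bestValue_le_norm_sub_sq (hσ : 0 < σ) (ha0 : 0 < a) (ha : ∀ᵐ y : ℝ, a ≤ D B σ y)
    (hb : ∀ᵐ y : ℝ, D B σ y ≤ b) (hρ : 0 < ρ) (hρσ : ρ ≤ σ) (f : L2R ℂ) {s : L2R ℂ}
    (hs : s ∈ shiftSpace B σ ρ) : bestValue B σ ρ f ≤ ‖f - s‖ ^ 2 := by
  obtain ⟨β, hβ, hv⟩ := hs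
  rw [(norm_sub_sq_eq hσ ha0 ha hb hρ hρσ f β hβ).2, le_add_iff_nonneg_right]
  refine mul_nonneg (by positivity) (integral_nonneg_of_ae ?_)
  filter_upwards [hv, ae_residual hσ ha0 ha hb f, ae_restrict_mem measurableSet_Icc]
    with y h1 h2 h3
  simp only [Pi.zero_apply, sub_nonneg]
  -- Inside `[-ρ, ρ]` the excess is a nonnegative square; outside, `S = 0` and it is `D|ζ|²` minus
  -- the density, which is `0`.
  by_cases hyI : y ∈ Set.Icc (-ρ) ρ
  · rw [Set.indicator_of_notMem (by simpa using hyI)]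
    exact mul_nonneg (D_nonneg B y) (by positivity)
  · rw [Set.indicator_of_mem (by simpa using hyI), ← h2,
      h1 ⟨by rwa [Set.mem_Icc, ← abs_le, not_le] at hyI, abs_le.2 h3⟩, zero_sub, norm_neg]

theorem exists_norm_sub_sq_eq_bestValue (hσ : 0 < σ) (ha0 : 0 < a)
    (ha : ∀ᵐ y : ℝ, a ≤ D B σ y) (hb : ∀ᵐ y : ℝ, D B σ y ≤ b)
    (hB : IsRieszSystem ℂ fun j : ℤ => shift (j * Real.pi / σ) B)
    (hρ : 0 < ρ) (hρσ : ρ ≤ σ) (f : L2R ℂ) :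
    ∃ s ∈ shiftSpace B σ ρ, ‖f - s‖ ^ 2 = bestValue B σ ρ f := by
  -- The fibrewise optimal `S`: `ζ` on `[-ρ, ρ]` and `0` elsewhere.
  have hz := (memLp_zeta hσ ha0 ha hb f).indicator (measurableSet_Icc (a := -ρ) (b := ρ))
  obtain ⟨β, hβ⟩ := exists_trigSeries_eq hσ (hz.toLp _)
  have hβ' : ∀ᵐ y ∂(mu σ), trigSeries σ β y = (Set.Icc (-ρ) ρ).indicator (zeta B σ f) y := by
    rw [hβ]
    exact hz.coeFn_toLp
  obtain ⟨_, _, _, _, h⟩ := hB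
  have hs := (h β).1.hasSum
  refine ⟨_, ⟨β, hs, ?_⟩, ?_⟩
  · filter_upwards [hβ'] with y hy hyρ
    rw [hy, Set.indicator_of_notMem]
    rw [Set.mem_Icc, ← abs_le, not_le]
    exact hyρ.1
  · rw [(norm_sub_sq_eq hσ ha0 ha hb hρ hρσ f β hs).2, add_eq_left]
    refine mul_eq_zero_of_right _ (integral_eq_zero_of_ae ?_)
    filter_upwards [hβ', ae_residual hσ ha0 ha hb f] with y h1 h2
    simp only [Pi.zero_apply, h1]
    by_cases hyI : y ∈ Set.Icc (-ρ) ρ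
    · rw [Set.indicator_of_mem hyI, Set.indicator_of_notMem (by simpa using hyI)]
      simp
    · rw [Set.indicator_of_notMem hyI, Set.indicator_of_mem (by simpa using hyI), ← h2]
      simp

theorem intervalIntegrable_projDensity (hσ : 0 < σ) (ha0 : 0 < a)
    (ha : ∀ᵐ y : ℝ, a ≤ D B σ y) (hρ : 0 < ρ) (hρσ : ρ ≤ σ) (f : L2R ℂ) :
    IntervalIntegrable (projDensity B σ f) volume (-ρ) ρ := by
  rw [intervalIntegrable_iff_integrableOn_Icc_of_le (by linarith)]
  have h : IntegrableOn (projDensity B σ f) (Set.Icc (-σ) σ) := integrable_projDensity hσ ha0 ha f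
  exact h.mono_set (Set.Icc_subset_Icc (by linarith) hρσ)

end BestApproximation

variable {𝕜 : Type*} [RCLike 𝕜]

/-! ### Passing between `𝕜` and `ℂ`: scalars, coefficients, functions -/

section ScalarMaps

/-- The real-linear retraction of `ℂ` onto the scalar field: the identity if `𝕜` is complex,
the real part if `𝕜` is real. -/
abbrev fromC (𝕜 : Type*) [RCLike 𝕜] : ℂ →L[ℝ] 𝕜 := RCLike.map ℂ 𝕜

theorem toC_re (a : 𝕜) : (toC 𝕜 a).re = RCLike.re a := by simp [toC]

theorem toC_im (a : 𝕜) : (toC 𝕜 a).im = RCLike.im a := by simp [toC]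

theorem toC_mul (a b : 𝕜) : toC 𝕜 (a * b) = toC 𝕜 a * toC 𝕜 b := by
  apply Complex.ext <;> simp only [toC_re, toC_im, Complex.mul_re, Complex.mul_im, RCLike.mul_re,
    RCLike.mul_im]

theorem norm_toC (a : 𝕜) : ‖toC 𝕜 a‖ = ‖a‖ := by
  rw [← sq_eq_sq₀ (norm_nonneg _) (norm_nonneg _), Complex.sq_norm, Complex.normSq_apply,
    toC_re, toC_im, RCLike.norm_sq_eq_def]

theorem fromC_apply (z : ℂ) : fromC 𝕜 z = (z.re : 𝕜) + (z.im : 𝕜) * RCLike.I := rfl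

theorem fromC_toC (a : 𝕜) : fromC 𝕜 (toC 𝕜 a) = a := by
  rw [fromC_apply, toC_re, toC_im, RCLike.re_add_im]

theorem im_I_sq : RCLike.im (RCLike.I : 𝕜) ^ 2 = 0 ∨ RCLike.im (RCLike.I : 𝕜) ^ 2 = 1 := by
  rcases RCLike.I_mul_I (K := 𝕜) with h | h
  · left
    simp [h]
  · right
    have := congrArg RCLike.re h
    rw [RCLike.mul_re, RCLike.I_re, map_neg, RCLike.one_re] at this
    linarith

theorem norm_fromC_le (z : ℂ) : ‖fromC 𝕜 z‖ ≤ ‖z‖ := by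
  rw [← sq_le_sq₀ (norm_nonneg _) (norm_nonneg _), Complex.sq_norm, Complex.normSq_apply,
    RCLike.norm_sq_eq_def]
  simp only [fromC, RCLike.map_apply, RCLike.re_eq_complex_re, RCLike.im_eq_complex_im, map_add,
    RCLike.ofReal_re, RCLike.ofReal_im, RCLike.mul_re, RCLike.mul_im, RCLike.I_re]
  rcases im_I_sq (𝕜 := 𝕜) with h | h
  · rw [pow_eq_zero_iff two_ne_zero] at h
    rw [h]
    nlinarith [mul_self_nonneg z.im]
  · nlinarith

theorem toC_fromC_of_I_ne_zero (h : (RCLike.I : 𝕜) ≠ 0) (z : ℂ) : toC 𝕜 (fromC 𝕜 z) = z := by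
  have h1 : RCLike.im (RCLike.I : 𝕜) = 1 := by
    have h2 := RCLike.mul_im_I_ax (RCLike.I : 𝕜)
    refine mul_left_cancel₀ (fun h0 => h ?_) (h2.trans (mul_one _).symm)
    rw [← RCLike.re_add_im (RCLike.I : 𝕜), h0, RCLike.I_re]
    simp
  apply Complex.ext
  · rw [toC_re, fromC_apply]
    simp
  · rw [toC_im, fromC_apply]
    simp [h1]

theorem toC_fromC_of_I_eq_zero (h : (RCLike.I : 𝕜) = 0) (z : ℂ) :
    toC 𝕜 (fromC 𝕜 z) = (z.re : ℂ) := by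
  rw [fromC_apply, h, mul_zero, add_zero]
  apply Complex.ext
  · rw [toC_re]
    simp
  · rw [toC_im]
    simp

/-- Linearity of the retraction over `𝕜`, needed to carry it through series of shifts. -/
theorem fromC_mul_toC (z : ℂ) (a : 𝕜) : fromC 𝕜 (z * toC 𝕜 a) = fromC 𝕜 z * a := by
  by_cases h : (RCLike.I : 𝕜) = 0
  · have ha : RCLike.im a = 0 := RCLike.im_eq_zero h a
    have ha' : ((RCLike.re a : ℝ) : 𝕜) = a := by
      conv_rhs => rw [← RCLike.re_add_im a, ha]
      simp
    rw [fromC_apply, fromC_apply, h, mul_zero, mul_zero, add_zero, add_zero, Complex.mul_re,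
      toC_re, toC_im, ha, mul_zero, sub_zero, RCLike.ofReal_mul, ha']
  · have h1 : toC 𝕜 (fromC 𝕜 (z * toC 𝕜 a)) = toC 𝕜 (fromC 𝕜 z * a) := by
      rw [toC_mul, toC_fromC_of_I_ne_zero h, toC_fromC_of_I_ne_zero h]
    rw [← fromC_toC (fromC 𝕜 (z * toC 𝕜 a)), h1, fromC_toC]

/-- The second real coordinate of a complex number over the scalar field. -/
def imPart (𝕜 : Type*) [RCLike 𝕜] (z : ℂ) : 𝕜 := fromC 𝕜 (-Complex.I * (z - toC 𝕜 (fromC 𝕜 z)))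

theorem toC_fromC_add_I_mul (z : ℂ) :
    toC 𝕜 (fromC 𝕜 z) + Complex.I * toC 𝕜 (imPart 𝕜 z) = z := by
  by_cases h : (RCLike.I : 𝕜) = 0
  · rw [imPart, toC_fromC_of_I_eq_zero h, toC_fromC_of_I_eq_zero h]
    apply Complex.ext <;> simp
  · rw [imPart, toC_fromC_of_I_ne_zero h, sub_self, mul_zero, map_zero, map_zero]
    simp

theorem norm_imPart_le (z : ℂ) : ‖imPart 𝕜 z‖ ≤ 2 * ‖z‖ := by
  refine (norm_fromC_le _).trans ?_
  rw [norm_mul, norm_neg, Complex.norm_I, one_mul, two_mul]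
  refine (norm_sub_le _ _).trans (add_le_add_right ?_ _)
  rw [norm_toC]
  exact norm_fromC_le z

end ScalarMaps

section EllMaps

theorem norm_sq_eq_tsum_ell (β : lp (fun _ : ℤ => 𝕜) 2) : ‖β‖ ^ 2 = ∑' j, ‖β j‖ ^ 2 := by
  have := lp.norm_rpow_eq_tsum (p := 2) (by norm_num) β
  simpa using this

theorem summable_norm_sq_ell (β : lp (fun _ : ℤ => 𝕜) 2) : Summable fun j => ‖β j‖ ^ 2 := by
  have := lp.hasSum_norm (p := 2) (by norm_num) β
  simpa using this.summable

/-- The image of a square-summable family under a map of linear growth. -/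
def mapEll {K K' : Type*} [RCLike K] [RCLike K'] (g : K → K') {c : ℝ}
    (hg : ∀ z, ‖g z‖ ≤ c * ‖z‖) (β : lp (fun _ : ℤ => K) 2) : lp (fun _ : ℤ => K') 2 :=
  ⟨fun j => g (β j), memℓp_gen (by
    simp only [ENNReal.toReal_ofNat, Real.rpow_ofNat]
    refine Summable.of_nonneg_of_le (fun _ => by positivity) (fun j => ?_)
      ((summable_norm_sq_ell β).mul_left (c ^ 2))
    rw [← mul_pow]
    exact pow_le_pow_left₀ (norm_nonneg _) (hg _) 2)⟩

theorem norm_mapEll_sq_le {K K' : Type*} [RCLike K] [RCLike K'] (g : K → K') {c : ℝ}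
    (hg : ∀ z, ‖g z‖ ≤ c * ‖z‖) (β : lp (fun _ : ℤ => K) 2) :
    ‖mapEll g hg β‖ ^ 2 ≤ c ^ 2 * ‖β‖ ^ 2 := by
  rw [norm_sq_eq_tsum_ell, norm_sq_eq_tsum_ell, ← tsum_mul_left]
  refine (summable_norm_sq_ell _).tsum_le_tsum (fun j => ?_)
    ((summable_norm_sq_ell β).mul_left (c ^ 2))
  rw [← mul_pow]
  exact pow_le_pow_left₀ (norm_nonneg _) (hg _) 2

/-- Coefficients in `𝕜` regarded as complex coefficients. -/
def ellToC (β : lp (fun _ : ℤ => 𝕜) 2) : lp (fun _ : ℤ => ℂ) 2 :=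
  mapEll (toC 𝕜) (c := 1) (fun z => by rw [norm_toC, one_mul]) β

/-- The retraction of complex coefficients onto coefficients in `𝕜`. -/
def ellFromC (𝕜 : Type*) [RCLike 𝕜] (β : lp (fun _ : ℤ => ℂ) 2) : lp (fun _ : ℤ => 𝕜) 2 :=
  mapEll (fromC 𝕜) (c := 1) (fun z => by rw [one_mul]; exact norm_fromC_le z) β

theorem ellToC_apply (β : lp (fun _ : ℤ => 𝕜) 2) (j : ℤ) : ellToC β j = toC 𝕜 (β j) := rfl

theorem ellFromC_apply (β : lp (fun _ : ℤ => ℂ) 2) (j : ℤ) :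
    ellFromC 𝕜 β j = fromC 𝕜 (β j) := rfl

theorem norm_ellToC_sq_le (β : lp (fun _ : ℤ => 𝕜) 2) : ‖ellToC β‖ ^ 2 ≤ ‖β‖ ^ 2 := by
  refine (norm_mapEll_sq_le (toC 𝕜) (c := 1) _ β).trans_eq ?_
  rw [one_pow, one_mul]

end EllMaps

section LpMaps

theorem compLp_toC_coeFn (f : L2R 𝕜) : ∀ᵐ x : ℝ, (toC 𝕜).compLp f x = toC 𝕜 (f x) :=
  (toC 𝕜).coeFn_compLp f

theorem norm_compLp_toC (f : L2R 𝕜) : ‖(toC 𝕜).compLp f‖ = ‖f‖ := by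
  rw [Lp.norm_def, Lp.norm_def]
  refine congrArg ENNReal.toReal (eLpNorm_congr_norm_ae ?_)
  filter_upwards [compLp_toC_coeFn f] with x hx
  rw [hx, norm_toC]

theorem norm_compLp_fromC_le (f : L2R ℂ) : ‖(fromC 𝕜).compLp f‖ ≤ ‖f‖ := by
  refine Lp.norm_le_norm_of_ae_le ?_
  filter_upwards [(fromC 𝕜).coeFn_compLp f] with x hx
  rw [hx]
  exact norm_fromC_le _

theorem compLp_fromC_toC (f : L2R 𝕜) : (fromC 𝕜).compLp ((toC 𝕜).compLp f) = f := by
  refine Lp.ext ?_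
  filter_upwards [(fromC 𝕜).coeFn_compLp ((toC 𝕜).compLp f), compLp_toC_coeFn f] with x h1 h2
  rw [h1, h2, fromC_toC]

theorem compLp_toC_smul (c : 𝕜) (f : L2R 𝕜) :
    (toC 𝕜).compLp (c • f) = toC 𝕜 c • (toC 𝕜).compLp f := by
  refine Lp.ext ?_
  filter_upwards [compLp_toC_coeFn (c • f), compLp_toC_coeFn f, Lp.coeFn_smul c f,
    Lp.coeFn_smul (toC 𝕜 c) ((toC 𝕜).compLp f)] with x h1 h2 h3 h4
  rw [h1, h3, h4, Pi.smul_apply, Pi.smul_apply, h2, smul_eq_mul, smul_eq_mul, toC_mul]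

theorem compLp_fromC_smul_toC (z : ℂ) (f : L2R 𝕜) :
    (fromC 𝕜).compLp (z • (toC 𝕜).compLp f) = fromC 𝕜 z • f := by
  refine Lp.ext ?_
  filter_upwards [(fromC 𝕜).coeFn_compLp (z • (toC 𝕜).compLp f), compLp_toC_coeFn f,
    Lp.coeFn_smul (fromC 𝕜 z) f, Lp.coeFn_smul z ((toC 𝕜).compLp f)] with x h1 h2 h3 h4
  rw [h1, h3, h4, Pi.smul_apply, Pi.smul_apply, h2, smul_eq_mul, smul_eq_mul, fromC_mul_toC]

theorem shift_compLp_toC (a : ℝ) (f : L2R 𝕜) :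
    shift a ((toC 𝕜).compLp f) = (toC 𝕜).compLp (shift a f) := by
  refine Lp.ext ?_
  filter_upwards [shift_coeFn a ((toC 𝕜).compLp f), compLp_toC_coeFn (shift a f),
    shift_coeFn a f, (measurePreserving_sub_right volume a).quasiMeasurePreserving.ae
      (compLp_toC_coeFn f)] with x h1 h2 h3 h4
  rw [h1, h2, h3, h4]

theorem hasSum_compLp_toC {β : lp (fun _ : ℤ => 𝕜) 2} {σ : ℝ} {B s : L2R 𝕜}
    (h : HasSum (fun j : ℤ => β j • shift (j * Real.pi / σ) B) s) :
    HasSum (fun j : ℤ => ellToC β j • shift (j * Real.pi / σ) ((toC 𝕜).compLp B))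
      ((toC 𝕜).compLp s) := by
  have h' := h.mapL ((toC 𝕜).compLpL 2 volume)
  refine Eq.subst (motive := fun g => HasSum g _) (funext fun j => ?_) h'
  rw [ellToC_apply, shift_compLp_toC, ← compLp_toC_smul]
  rfl

theorem hasSum_compLp_fromC {β : lp (fun _ : ℤ => ℂ) 2} {σ : ℝ} {B : L2R 𝕜} {s : L2R ℂ}
    (h : HasSum (fun j : ℤ => β j • shift (j * Real.pi / σ) ((toC 𝕜).compLp B)) s) :
    HasSum (fun j : ℤ => ellFromC 𝕜 β j • shift (j * Real.pi / σ) B) ((fromC 𝕜).compLp s) := by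
  have h' := h.mapL ((fromC 𝕜).compLpL 2 volume)
  refine Eq.subst (motive := fun g => HasSum g _) (funext fun j => ?_) h'
  rw [ellFromC_apply, shift_compLp_toC, ← compLp_fromC_smul_toC]
  rfl

end LpMaps

/-! ### Reduction of a general scalar field to `ℂ` -/

section Complexification

variable {σ : ℝ}

/-- Complex coefficients split as `β₁ + iβ₂` over `𝕜`, with `β₂ = 0` when `𝕜` is already complex.
The constant `10` is `2 · (1 + 4)`: the `2` from squaring a sum of two norms, the `1` and `4` from
the squared bounds on the two parts. -/
theorem IsRieszSystem.complexify {B : L2R 𝕜}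
    (hB : IsRieszSystem 𝕜 fun j : ℤ => shift (j * Real.pi / σ) B) :
    IsRieszSystem ℂ fun j : ℤ => shift (j * Real.pi / σ) ((toC 𝕜).compLp B) := by
  obtain ⟨A, C, hA, hC, h⟩ := hB
  refine ⟨A / 10, 10 * C, by positivity, by positivity, fun β => ?_⟩
  set β₁ := ellFromC 𝕜 β with hβ₁
  set β₂ : lp (fun _ : ℤ => 𝕜) 2 := mapEll (imPart 𝕜) norm_imPart_le β with hβ₂
  have hβ : β = ellToC β₁ + Complex.I • ellToC β₂ := by
    refine lp.ext (funext fun j => ?_)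
    exact (toC_fromC_add_I_mul (𝕜 := 𝕜) (β j)).symm
  obtain ⟨hs₁, hl₁, hu₁⟩ := h β₁
  obtain ⟨hs₂, hl₂, hu₂⟩ := h β₂
  set s₁ := ∑' j : ℤ, β₁ j • shift (j * Real.pi / σ) B with hs₁'
  set s₂ := ∑' j : ℤ, β₂ j • shift (j * Real.pi / σ) B with hs₂'
  have hsum : HasSum (fun j : ℤ => β j • shift (j * Real.pi / σ) ((toC 𝕜).compLp B))
      ((toC 𝕜).compLp s₁ + Complex.I • (toC 𝕜).compLp s₂) := by
    have h1 := (hasSum_compLp_toC hs₁.hasSum).add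
      ((hasSum_compLp_toC hs₂.hasSum).const_smul Complex.I)
    refine Eq.subst (motive := fun g => HasSum g _) (funext fun j => ?_) h1
    rw [smul_smul, ← add_smul]
    congr 1
    exact toC_fromC_add_I_mul (𝕜 := 𝕜) (β j)
  rw [hsum.tsum_eq]
  set s := (toC 𝕜).compLp s₁ + Complex.I • (toC 𝕜).compLp s₂ with hs
  have n₁ : ‖s₁‖ ≤ ‖s‖ := by
    have : (fromC 𝕜).compLp s = s₁ := (hasSum_compLp_fromC hsum).unique hs₁.hasSum
    rw [← this]
    exact norm_compLp_fromC_le s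
  have n₂ : ‖s₂‖ ≤ 2 * ‖s‖ := by
    have : ‖s₂‖ = ‖s - (toC 𝕜).compLp s₁‖ := by
      rw [hs, add_sub_cancel_left, norm_smul, Complex.norm_I, one_mul, norm_compLp_toC]
    rw [this]
    refine (norm_sub_le _ _).trans ?_
    rw [norm_compLp_toC]
    linarith
  have n₃ : ‖s‖ ≤ ‖s₁‖ + ‖s₂‖ := by
    refine (norm_add_le _ _).trans ?_
    rw [norm_smul, Complex.norm_I, one_mul, norm_compLp_toC, norm_compLp_toC]
  have m₁ : ‖β₁‖ ^ 2 ≤ ‖β‖ ^ 2 := by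
    refine (norm_mapEll_sq_le (fromC 𝕜) (c := 1) _ β).trans_eq ?_
    rw [one_pow, one_mul]
  have m₂ : ‖β₂‖ ^ 2 ≤ 4 * ‖β‖ ^ 2 := by
    have := norm_mapEll_sq_le (imPart 𝕜) norm_imPart_le β
    norm_num at this
    exact this
  have m₃ : ‖β‖ ≤ ‖β₁‖ + ‖β₂‖ := by
    have e₁ := (sq_le_sq₀ (norm_nonneg _) (norm_nonneg _)).1 (norm_ellToC_sq_le β₁)
    have e₂ := (sq_le_sq₀ (norm_nonneg _) (norm_nonneg _)).1 (norm_ellToC_sq_le β₂)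
    calc ‖β‖ = ‖ellToC β₁ + Complex.I • ellToC β₂‖ := congrArg _ hβ
      _ ≤ ‖ellToC β₁‖ + ‖Complex.I • ellToC β₂‖ := norm_add_le _ _
      _ = ‖ellToC β₁‖ + ‖ellToC β₂‖ := by rw [norm_smul, Complex.norm_I, one_mul]
      _ ≤ ‖β₁‖ + ‖β₂‖ := add_le_add e₁ e₂
  have q₁ : ‖s₁‖ ^ 2 ≤ ‖s‖ ^ 2 := pow_le_pow_left₀ (norm_nonneg _) n₁ 2
  have q₂ : ‖s₂‖ ^ 2 ≤ 4 * ‖s‖ ^ 2 := by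
    have := pow_le_pow_left₀ (norm_nonneg _) n₂ 2
    linarith [mul_pow 2 ‖s‖ 2]
  have q₃ : ‖s‖ ^ 2 ≤ 2 * (‖s₁‖ ^ 2 + ‖s₂‖ ^ 2) := by
    have := pow_le_pow_left₀ (norm_nonneg _) n₃ 2
    linarith [add_sq ‖s₁‖ ‖s₂‖, sq_nonneg (‖s₁‖ - ‖s₂‖), sub_sq ‖s₁‖ ‖s₂‖]
  have q₄ : ‖β‖ ^ 2 ≤ 2 * (‖β₁‖ ^ 2 + ‖β₂‖ ^ 2) := by
    have := pow_le_pow_left₀ (norm_nonneg _) m₃ 2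
    linarith [add_sq ‖β₁‖ ‖β₂‖, sq_nonneg (‖β₁‖ - ‖β₂‖), sub_sq ‖β₁‖ ‖β₂‖]
  refine ⟨hsum.summable, ?_, ?_⟩
  · have := mul_le_mul_of_nonneg_left q₄ hA.le
    linarith
  · have t₁ := mul_le_mul_of_nonneg_left m₁ hC.le
    have t₂ := mul_le_mul_of_nonneg_left m₂ hC.le
    linarith

theorem inner_trig_trigSeries (hσ : 0 < σ) (β : lp (fun _ : ℤ => ℂ) 2) (j : ℤ) :
    inner ℂ (trig σ (-j)) (trigSeries σ β) = 2 * σ * β j := by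
  have h := (hasSum_trigSeries' hσ β).mapL (innerSL ℂ (trig σ (-j)))
  have h' := hasSum_single (f := fun i : ℤ =>
    innerSL ℂ (trig σ (-j)) (β i • trig σ (-i))) j (fun i hi => by
      simp only [innerSL_apply_apply, inner_smul_right, inner_trig_trig hσ]
      rw [if_neg (fun h => hi (neg_injective h).symm), mul_zero])
  have h2 := h.unique h'
  simp only [innerSL_apply_apply, inner_smul_right, inner_trig_trig hσ, if_true] at h2
  rw [h2]
  push_cast
  ring

theorem measurePreserving_neg_mu (σ : ℝ) :
    MeasurePreserving (fun y : ℝ => -y) (mu σ) (mu σ) := by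
  have h := (Measure.measurePreserving_neg (volume : Measure ℝ)).restrict_preimage
    (measurableSet_Icc (a := -σ) (b := σ))
  have hs : (Neg.neg : ℝ → ℝ) ⁻¹' Set.Icc (-σ) σ = Set.Icc (-σ) σ := by
    ext y
    simp only [Set.mem_preimage, Set.mem_Icc]
    constructor <;> rintro ⟨h1, h2⟩ <;> constructor <;> linarith
  rw [hs] at h
  exact h

/-- The conjugate reflection `y ↦ conj (g(-y))` on `L₂[-σ, σ]`. -/
def conjReflect (g : L2I σ) : L2I σ :=
  star (Lp.compMeasurePreserving _ (measurePreserving_neg_mu σ) g)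

theorem conjReflect_coeFn (g : L2I σ) :
    ∀ᵐ y ∂(mu σ), conjReflect g y = (starRingEnd ℂ) (g (-y)) := by
  filter_upwards [star_coeFn (Lp.compMeasurePreserving _ (measurePreserving_neg_mu σ) g),
    Lp.coeFn_compMeasurePreserving g (measurePreserving_neg_mu σ)] with y h1 h2
  rw [conjReflect, h1, h2]
  rfl

theorem inner_trig_conjReflect (j : ℤ) (g : L2I σ) :
    inner ℂ (trig σ j) (conjReflect g) = (starRingEnd ℂ) (inner ℂ (trig σ j) g) := by
  rw [inner_trig_eq_integral, inner_trig_eq_integral, ← integral_conj,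
    ← (measurePreserving_neg_mu σ).integral_comp (Homeomorph.neg ℝ).measurableEmbedding]
  refine integral_congr_ae ?_
  filter_upwards [(measurePreserving_neg_mu σ).quasiMeasurePreserving.ae
    (conjReflect_coeFn g)] with y hy
  rw [hy, map_mul, neg_neg]
  congr 1
  rw [conj_trigFun, trigFun, trigFun]
  push_cast
  congr 1
  ring

/-- Conjugating the coefficients amounts to the conjugate reflection of the series, so taking real
parts averages the two. Vanishing on the symmetric set `ρ < |y| ≤ σ` therefore survives. -/
theorem trigSeries_ellFromC_of_real (hσ : 0 < σ) (h : (RCLike.I : 𝕜) = 0)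
    (β : lp (fun _ : ℤ => ℂ) 2) : trigSeries σ (ellToC (ellFromC 𝕜 β)) =
      (1 / 2 : ℂ) • (trigSeries σ β + conjReflect (trigSeries σ β)) := by
  refine ext_inner_trig hσ fun j => ?_
  rw [inner_smul_right, inner_add_right, inner_trig_conjReflect, inner_trig_trigSeries hσ,
    inner_trig_trigSeries hσ, ellToC_apply, ellFromC_apply, toC_fromC_of_I_eq_zero h,
    Complex.re_eq_add_conj]
  simp only [map_mul, map_ofNat, Complex.conj_ofReal]
  ring

theorem trigSeries_ellToC (β : lp (fun _ : ℤ => 𝕜) 2) :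
    trigSeries σ (ellToC β) = trigSeries σ β := by
  rw [trigSeries, trigSeries]
  simp_rw [toC_complex, ellToC_apply]

theorem compLp_toC_mem_shiftSpace {ρ : ℝ} {B s : L2R 𝕜} (hs : s ∈ shiftSpace B σ ρ) :
    (toC 𝕜).compLp s ∈ shiftSpace ((toC 𝕜).compLp B) σ ρ := by
  obtain ⟨β, hβ, hv⟩ := hs
  refine ⟨ellToC β, hasSum_compLp_toC hβ, ?_⟩
  rw [trigSeries_ellToC]
  exact hv

theorem compLp_fromC_mem_shiftSpace (hσ : 0 < σ) {ρ : ℝ} {B : L2R 𝕜} {s : L2R ℂ}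
    (hs : s ∈ shiftSpace ((toC 𝕜).compLp B) σ ρ) :
    (fromC 𝕜).compLp s ∈ shiftSpace B σ ρ := by
  obtain ⟨β, hβ, hv⟩ := hs
  refine ⟨ellFromC 𝕜 β, hasSum_compLp_fromC hβ, ?_⟩
  rw [← trigSeries_ellToC]
  by_cases h : (RCLike.I : 𝕜) = 0
  · rw [trigSeries_ellFromC_of_real hσ h]
    filter_upwards [hv, (measurePreserving_neg_mu σ).quasiMeasurePreserving.ae hv,
      conjReflect_coeFn (trigSeries σ β),
      Lp.coeFn_smul (1 / 2 : ℂ) (trigSeries σ β + conjReflect (trigSeries σ β)),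
      Lp.coeFn_add (trigSeries σ β) (conjReflect (trigSeries σ β))] with y h1 h2 h3 h4 h5 hy
    rw [h4, Pi.smul_apply, h5, Pi.add_apply, h3, h1 hy, h2 (by rwa [abs_neg])]
    simp
  · have : ellToC (ellFromC 𝕜 β) = β :=
      lp.ext (funext fun j => toC_fromC_of_I_ne_zero h (β j))
    rw [this]
    exact hv

theorem bestApprox_sq_eq {f : L2R 𝕜} {N : Set (L2R 𝕜)} {V : ℝ}
    (hle : ∀ s ∈ N, V ≤ ‖f - s‖ ^ 2) (hex : ∃ s ∈ N, ‖f - s‖ ^ 2 ≤ V) :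
    bestApprox f N ^ 2 = V := by
  obtain ⟨s, hs, hsV⟩ := hex
  have hV : ‖f - s‖ ^ 2 = V := le_antisymm hsV (hle s hs)
  have : bestApprox f N = ‖f - s‖ := by
    refine le_antisymm (ciInf_le ⟨0, ?_⟩ (⟨s, hs⟩ : N)) ?_
    · rintro _ ⟨T, rfl⟩
      exact norm_nonneg _
    · have : Nonempty N := ⟨⟨s, hs⟩⟩
      refine le_ciInf fun T => ?_
      rw [← sq_le_sq₀ (norm_nonneg _) (norm_nonneg _), hV]
      exact hle T T.2
  rw [this, hV]

theorem compLp_toC_sub (f g : L2R 𝕜) :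
    (toC 𝕜).compLp (f - g) = (toC 𝕜).compLp f - (toC 𝕜).compLp g :=
  map_sub ((toC 𝕜).compLpL 2 volume) f g

theorem compLp_fromC_sub (f g : L2R ℂ) :
    (fromC 𝕜).compLp (f - g) = (fromC 𝕜).compLp f - (fromC 𝕜).compLp g :=
  map_sub ((fromC 𝕜).compLpL 2 volume) f g

/-- The embedding is isometric, so the lower bound restricts to `𝕜`. The retraction fixes `f`, does
not increase norms and respects the shift spaces, so it sends a complex minimizer to one over `𝕜`.
-/
theorem bestApprox_sq_of_complex (hσ : 0 < σ) {ρ V : ℝ} {B f : L2R 𝕜}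
    (hle : ∀ s ∈ shiftSpace ((toC 𝕜).compLp B) σ ρ, V ≤ ‖(toC 𝕜).compLp f - s‖ ^ 2)
    (hex : ∃ s ∈ shiftSpace ((toC 𝕜).compLp B) σ ρ, ‖(toC 𝕜).compLp f - s‖ ^ 2 = V) :
    bestApprox f (shiftSpace B σ ρ) ^ 2 = V := by
  refine bestApprox_sq_eq (fun s hs => ?_) ?_
  · have := hle _ (compLp_toC_mem_shiftSpace hs)
    rwa [← compLp_toC_sub, norm_compLp_toC] at this
  · obtain ⟨s, hs, hsV⟩ := hex
    refine ⟨_, compLp_fromC_mem_shiftSpace hσ hs, ?_⟩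
    rw [← hsV]
    refine pow_le_pow_left₀ (norm_nonneg _) ?_ 2
    have h := norm_compLp_fromC_le (𝕜 := 𝕜) ((toC 𝕜).compLp f - s)
    rwa [compLp_fromC_sub, compLp_fromC_toC] at h

theorem D_compLp_toC (B : L2R 𝕜) : D ((toC 𝕜).compLp B) σ = D B σ := by
  ext y
  rw [D, D, hat_compLp_toC]

theorem crossTerm_compLp_toC (B f : L2R 𝕜) :
    crossTerm ((toC 𝕜).compLp B) σ ((toC 𝕜).compLp f) = crossTerm B σ f := by
  ext k y
  rw [crossTerm, crossTerm, hat_compLp_toC, hat_compLp_toC]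

theorem ae_sample_compLp_toC (B : L2R 𝕜) (σ : ℝ) :
    ∀ᵐ x : ℝ, ∀ j : ℤ, (toC 𝕜).compLp B (x - j * Real.pi / σ) =
      toC 𝕜 (B (x - j * Real.pi / σ)) :=
  ae_all_iff.2 fun _ => (measurePreserving_sub_right volume _).quasiMeasurePreserving.ae
    (compLp_toC_coeFn B)

theorem ae_Phi_compLp_toC (B : L2R 𝕜) (σ : ℝ) :
    ∀ᵐ x : ℝ, Phi ((toC 𝕜).compLp B) σ x = Phi B σ x := by
  filter_upwards [ae_sample_compLp_toC B σ] with x hx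
  rw [Phi, Phi]
  simp_rw [toC_complex, hx]

theorem ae_integrand_compLp_toC (B f : L2R 𝕜) (σ : ℝ) :
    ∀ᵐ t : ℝ, (toC 𝕜).compLp f t • (star (Phi ((toC 𝕜).compLp B) σ t) : L2I σ) =
      toC 𝕜 (f t) • star (Phi B σ t) := by
  filter_upwards [ae_Phi_compLp_toC B σ, compLp_toC_coeFn f] with t h1 h2
  rw [h1, h2]

theorem truncInt_compLp_toC (B f : L2R 𝕜) :
    truncInt ((toC 𝕜).compLp B) σ ((toC 𝕜).compLp f) = truncInt B σ f := by
  ext1 n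
  rw [truncInt_eq, truncInt,
    intervalIntegral.integral_of_le (by linarith [n.cast_nonneg (α := ℝ)])]
  exact integral_congr_ae (ae_restrict_of_ae (ae_integrand_compLp_toC B f σ))

theorem fullInt_compLp_toC (B f : L2R 𝕜) :
    fullInt ((toC 𝕜).compLp B) σ ((toC 𝕜).compLp f) = fullInt B σ f := by
  rw [fullInt, fullInt, truncInt_compLp_toC]

theorem zeta_compLp_toC (B f : L2R 𝕜) :
    zeta ((toC 𝕜).compLp B) σ ((toC 𝕜).compLp f) = zeta B σ f := by
  ext y
  rw [zeta, zeta, fullInt_compLp_toC, D_compLp_toC]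

end Complexification

end ShiftSpace

end

theorem theorem2 {𝕜 : Type*} [RCLike 𝕜] (σ : ℝ) (hσ : 0 < σ)
    (B : ShiftSpace.L2R 𝕜)
    (hB : ShiftSpace.IsRieszSystem 𝕜
      (fun j : ℤ => ShiftSpace.shift (j * Real.pi / σ) B))
    (f : ShiftSpace.L2R 𝕜) :
    -- the objects entering the formulas are well defined
    ((∀ᵐ x : ℝ, Summable fun j : ℤ =>
        ShiftSpace.toC 𝕜 (B (x - j * Real.pi / σ)) • ShiftSpace.trig σ j) ∧
      (∀ n : ℕ, IntervalIntegrable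
        (fun t => ShiftSpace.toC 𝕜 (f t) • star (ShiftSpace.Phi B σ t)) volume (-(n : ℝ)) n) ∧
      Tendsto (ShiftSpace.truncInt B σ f) atTop (𝓝 (ShiftSpace.fullInt B σ f)) ∧
      (∀ᵐ y : ℝ, (Summable fun ν : ℤ => ‖ShiftSpace.hat B (y + 2 * ν * σ)‖ ^ 2) ∧
        0 < ShiftSpace.D B σ y ∧
        Summable fun k : ℤ => ShiftSpace.crossTerm B σ f k y)) ∧
    -- the formula for the transform, in `L₂[-σ, σ]`
    (MemLp (ShiftSpace.zeta B σ f) 2 (ShiftSpace.mu σ) ∧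
      (∀ᵐ y ∂(ShiftSpace.mu σ), ShiftSpace.zeta B σ f y =
        (1 / ShiftSpace.D B σ y : ℂ) * ∑' k : ℤ, ShiftSpace.crossTerm B σ f k y) ∧
      Tendsto (fun K : Finset ℤ => eLpNorm (fun y => ShiftSpace.zeta B σ f y -
        (1 / ShiftSpace.D B σ y : ℂ) * ∑ k ∈ K, ShiftSpace.crossTerm B σ f k y) 2
          (ShiftSpace.mu σ)) atTop (𝓝 0)) ∧
    -- the formula for the best approximation
    (∀ ρ : ℝ, 0 < ρ → ρ ≤ σ →
      IntervalIntegrable (fun y => 1 / ShiftSpace.D B σ y *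
        ‖∑' k : ℤ, ShiftSpace.crossTerm B σ f k y‖ ^ 2) volume (-ρ) ρ ∧
      ShiftSpace.bestApprox f (ShiftSpace.shiftSpace B σ ρ) ^ 2 =
        2 * Real.pi * ((∫ y : ℝ, ‖ShiftSpace.hat f y‖ ^ 2) -
          ∫ y in (-ρ)..ρ, 1 / ShiftSpace.D B σ y *
            ‖∑' k : ℤ, ShiftSpace.crossTerm B σ f k y‖ ^ 2)) := by
  -- Each claim is proved for the complex images of `B` and `f` and carried back: `hat`, `D`,
  -- `crossTerm`, `truncInt` and `zeta` are unchanged by the embedding.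
  have hR := hB.complexify
  obtain ⟨a, b, ha0, _, hab⟩ := ShiftSpace.exists_D_bounds hσ _ hR
  have ha := hab.mono fun _ h => h.1
  have hb := hab.mono fun _ h => h.2
  refine ⟨⟨?_, fun n => ?_, ?_, ?_⟩, ⟨?_, ?_, ?_⟩, fun ρ hρ hρσ => ⟨?_, ?_⟩⟩
  · filter_upwards [ShiftSpace.ae_sampleSq_lt_top hσ ((ShiftSpace.toC 𝕜).compLp B),
      ShiftSpace.ae_sample_compLp_toC B σ] with x h1 h2
    simp_rw [← h2]
    exact (ShiftSpace.Phi_eq hσ h1).1.summable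
  · rw [intervalIntegrable_iff_integrableOn_Ioc_of_le (by linarith [n.cast_nonneg (α := ℝ)])]
    exact (ShiftSpace.integrableOn_smul_star_Phi hσ _ _ n).congr
      (ae_restrict_of_ae (ShiftSpace.ae_integrand_compLp_toC B f σ))
  · rw [← ShiftSpace.truncInt_compLp_toC, ← ShiftSpace.fullInt_compLp_toC,
      ShiftSpace.fullInt_eq hσ hb]
    exact ShiftSpace.tendsto_truncInt hσ hb _
  · rw [← ShiftSpace.D_compLp_toC, ← ShiftSpace.crossTerm_compLp_toC,
      ← ShiftSpace.hat_compLp_toC B]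
    filter_upwards [ha, ShiftSpace.ae_summable_hat_sq hσ ((ShiftSpace.toC 𝕜).compLp B),
      ShiftSpace.ae_summable_crossTerm hσ ((ShiftSpace.toC 𝕜).compLp B)
        ((ShiftSpace.toC 𝕜).compLp f)] with y h1 h2 h3
    exact ⟨h2, ha0.trans_le h1, h3⟩
  · rw [← ShiftSpace.zeta_compLp_toC]
    exact ShiftSpace.memLp_zeta hσ ha0 ha hb _
  · rw [← ShiftSpace.zeta_compLp_toC, ← ShiftSpace.D_compLp_toC,
      ← ShiftSpace.crossTerm_compLp_toC]
    exact ShiftSpace.zeta_eq hσ hb _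
  · rw [← ShiftSpace.zeta_compLp_toC, ← ShiftSpace.D_compLp_toC,
      ← ShiftSpace.crossTerm_compLp_toC]
    exact ShiftSpace.tendsto_eLpNorm_zeta_sub hσ ha0 ha hb _
  · rw [← ShiftSpace.D_compLp_toC, ← ShiftSpace.crossTerm_compLp_toC]
    exact ShiftSpace.intervalIntegrable_projDensity hσ ha0 ha hρ hρσ _
  · rw [← ShiftSpace.D_compLp_toC, ← ShiftSpace.crossTerm_compLp_toC,
      ← ShiftSpace.hat_compLp_toC f]
    exact ShiftSpace.bestApprox_sq_of_complex hσ
      (fun s hs => ShiftSpace.bestValue_le_norm_sub_sq hσ ha0 ha hb hρ hρσ _ hs)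
      (ShiftSpace.exists_norm_sub_sq_eq_bestValue hσ ha0 ha hb hR hρ hρσ _)
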